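/- **Conventions.** A cube complex is obtained from cubes $[0,1]^n$ $(n\ge 0)$ glued along faces by isometries; it is $\mathrm{CAT}(0)$ if it is simply connected and the link of every vertex is a flag complex (no finiteness or dimension assumption is made). Let $X$ be a $\mathrm{CAT}(0)$ cube complex with combinatorial metric $d$ on its vertices (the length of a shortest edge path). Each hyperplane of $X$ has two complementary components, which give a pair of opposite half-spaces $H,\overline H$; half-spaces are identified with their vertex sets, so that $\overline H$ is the complement of $H$. Two half-spaces $H,K$ are transverse if $H\cap K$, $H\cap\overline K$, $\overline H\cap K$, $\overline H\cap\overline K$ are all non-empty. Let $g$ be an automorphism of $X$ and $\ell_g=\min_v d(v,gv)$ its translation distance ($v$ ranging over the vertices). We call $g$ hyperbolic if all elements of $\langle g\rangle$ act without inversion (none of them maps a half-space $H$ to $\overline H$) and $\ell_g>0$. A combinatorial axis of $g$ is a bi-infinite geodesic edge path $(x_i)_{i\in\mathbb Z}$ with $gx_i=x_{i+\ell_g}$ for all $i$. Let $A_g^+$ be the set of half-spaces $H$ such that $x_i\notin H$, $x_{i+1}\in H$ for some combinatorial axis $(x_i)$ of $g$ and some $i$, and put $A_g=A_g^+\cup\{\overline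 H: H\in A_g^+\}$. The *essential characteristic set* $X^{ess}_g$ is the cube complex obtained from $A_g$ by the Sageev construction. Its vertices are the sets $\sigma\subseteq A_g$ that contain exactly one half-space of each pair $H,\overline H$ in $A_g$, contain no two disjoint half-spaces, and differ from $\pi_g(v)=\{H\in A_g: v\in H\}$ in only finitely many half-spaces for some vertex $v$ of $X$; its edges join vertices that differ on exactly one pair $H,\overline H$; and a cube is added whenever its $1$-skeleton is present. The half-spaces of $X^{ess}_g$ are the sets of vertices $\{\sigma: H\in\sigma\}$, $H\in A_g$, and are denoted again by $H$. For $k>0$ we say that $\langle g^k\rangle$ acts *non-transversely* on $X^{ess}_g$ if for no $H\in A_g$ the half-spaces $H$ and $g^kH$ of $X^{ess}_g$ are transverse. The minimal set $M_g$ is the full subcomplex of $X$ spanned by the vertices $v$ with $d(v,gv)=\ell_g$. The *essential minimal set* $M^{ess}_g$ is the subcomplex of $X^{ess}_g$ that is the image of $M_g$ under the projection induced by $v\mapsto\pi_g(v)$. (The same definitions apply to the powers $g^k$, $k>0$, which are hyperbolic with $A_{g^k}=A_g$, so that $M^{ess}_{g^k}\subseteq X^{ess}_{g^k}=X^{ess}_g$.)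 **Statement.** Let $g$ be a hyperbolic automorphism of a $\mathrm{CAT}(0)$ cube complex $X$. Then the following are equivalent: 1. there is an integer $k>0$ such that $\langle g^k\rangle$ acts non-transversely on $X^{ess}_g$; 2. $X^{ess}_g=M^{ess}_{g^k}$ for some integer $k>0$; 3. $X^{ess}_g$ is finite-dimensional. -/

import Mathlib

/-- The data of a complex of cubes with vertices in `V`. An `n`-cube is recorded by each of its
parametrisations `f : {0,1}ⁿ → V`, which list its vertices; `IsCube n f` says that `f` parametrises
an `n`-cube of the complex. The vertices are the `0`-cubes. -/
@[ext]
structure CubeFamily (V : Type*) where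
  IsCube : ∀ n : ℕ, ((Fin n → Bool) → V) → Prop

namespace CubeFamily

section Complexes

variable {V : Type*} (X : CubeFamily V)

/-- The set of vertices. -/
def vertexSet : Set V := {v | X.IsCube 0 (fun _ => v)}

/-- `X` is finite-dimensional: the dimensions of its cubes are bounded. -/
def FiniteDimensional : Prop := ∃ d : ℕ, ∀ n f, X.IsCube n f → n ≤ d

/-- `φ : {0,1}ᵏ → {0,1}ⁿ` is an isometric parametrisation of a face. (Maps preserving the Hamming
distance are exactly the restrictions to the vertices of the isometries of `[0,1]ᵏ` onto the
`k`-dimensional faces of `[0,1]ⁿ`; for `k = n` they are the symmetries of the cube.) -/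
def IsFaceMap {k n : ℕ} (φ : (Fin k → Bool) → (Fin n → Bool)) : Prop :=
  ∀ x y, hammingDist (φ x) (φ y) = hammingDist x y

/-- `X` is a cube complex with vertex set the whole of `V`: cubes are embedded, faces of cubes are
cubes (in all their parametrisations), and two cubes that meet do so in a common face, along an
isometry of faces. -/
structure IsCubeComplex : Prop where
  vertex : ∀ v : V, X.IsCube 0 (fun _ => v)
  injective : ∀ n f, X.IsCube n f → Function.Injective f
  face : ∀ n f, X.IsCube n f → ∀ (k : ℕ) (φ : (Fin k → Bool) → (Fin n → Bool)),
    IsFaceMap φ → X.IsCube k (f ∘ φ)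
  inter : ∀ m f n f', X.IsCube m f → X.IsCube n f' → (Set.range f ∩ Set.range f').Nonempty →
    ∃ (k : ℕ) (φ : (Fin k → Bool) → (Fin m → Bool)) (ψ : (Fin k → Bool) → (Fin n → Bool)),
      IsFaceMap φ ∧ IsFaceMap ψ ∧ f ∘ φ = f' ∘ ψ ∧
        Set.range f ∩ Set.range f' = Set.range (f ∘ φ)

/-- The `1`-skeleton of `X`, as a graph. -/
def skeleton : SimpleGraph V where
  Adj v w := v ≠ w ∧ ∃ f, X.IsCube 1 f ∧ Set.range f = {v, w}
  symm := ⟨fun _ _ h => ⟨h.1.symm, h.2.imp fun _ hf => ⟨hf.1, hf.2.trans (Set.pair_comm _ _)⟩⟩⟩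
  loopless := ⟨fun _ h => h.1 rfl⟩

/-- `a, b, c, d` are, in cyclic order, the vertices of a square of `X`. -/
def IsSquare (a b c d : V) : Prop :=
  ∃ f, X.IsCube 2 f ∧ f ![false, false] = a ∧ f ![true, false] = b ∧
    f ![true, true] = c ∧ f ![false, true] = d

/-- There is an `n`-cube with a corner at `v` whose edges at `v` end at `w 0, …, w (n - 1)`:
these edges span a simplex of the link of `v`. -/
def SpansCube (v : V) {n : ℕ} (w : Fin n → V) : Prop :=
  ∃ f, X.IsCube n f ∧ f (fun _ => false) = v ∧ ∀ i, f (fun j => decide (j = i)) = w i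

/-- The link of every vertex is a flag complex: finitely many distinct edges at `v` which pairwise
span squares span a cube. -/
def FlagLinks : Prop :=
  ∀ (v : V) (n : ℕ) (w : Fin n → V), Function.Injective w → (∀ i, X.skeleton.Adj v (w i)) →
    (∀ i j, i ≠ j → X.SpansCube v ![w i, w j]) → X.SpansCube v w

/-- Elementary homotopies of edge paths with fixed endpoints: deleting a backtracking, and pushing
a path across a square. -/
inductive ElementaryHomotopy : ∀ {u v : V}, X.skeleton.Walk u v → X.skeleton.Walk u v → Prop
  | backtrack {u v a b : V} (p : X.skeleton.Walk u a) (h : X.skeleton.Adj a b)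
      (q : X.skeleton.Walk a v) :
      ElementaryHomotopy (p.append (.cons h (.cons h.symm q))) (p.append q)
  | square {u v a b c d : V} (hsq : X.IsSquare a b c d) (p : X.skeleton.Walk u a)
      (hab : X.skeleton.Adj a b) (hbc : X.skeleton.Adj b c)
      (had : X.skeleton.Adj a d) (hdc : X.skeleton.Adj d c) (q : X.skeleton.Walk c v) :
      ElementaryHomotopy (p.append (.cons hab (.cons hbc q))) (p.append (.cons had (.cons hdc q)))

/-- `X` is simply connected: it is non-empty and connected, and every closed edge path is
null-homotopic, i.e. the edge-path group (the fundamental group) is trivial. -/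
def SimplyConnected : Prop :=
  X.skeleton.Connected ∧ ∀ (v : V) (p : X.skeleton.Walk v v),
    Relation.EqvGen X.ElementaryHomotopy p SimpleGraph.Walk.nil

/-- `X` is a CAT(0) cube complex: non-positively curved (all links are flag) and simply
connected. -/
structure IsCAT0 : Prop where
  isCubeComplex : X.IsCubeComplex
  flagLinks : X.FlagLinks
  simplyConnected : X.SimplyConnected

/-- Two edges are parallel if they are joined by a chain of edges in which consecutive ones are
opposite edges of a square, i.e. if they are dual to the same hyperplane. -/
def Parallel : Sym2 V → Sym2 V → Prop :=
  Relation.EqvGen fun e e' => ∃ a b c d, X.IsSquare a b c d ∧ e = s(a, b) ∧ e' = s(d, c)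

/-- `H` is (the set of vertices of) a half-space: a component of the complement of the hyperplane
dual to some edge `e`. The opposite half-space is `Hᶜ`. -/
def IsHalfSpace (H : Set V) : Prop :=
  ∃ e ∈ X.skeleton.edgeSet, ∃ v : V,
    H = {w | (X.skeleton.deleteEdges {e' | X.Parallel e e'}).Reachable v w}

end Complexes

section Automorphisms

variable {V : Type*} (X : CubeFamily V) (g : Equiv.Perm V)

/-- `g` is an automorphism of the cube complex `X`. -/
def IsAutomorphism : Prop := ∀ n f, X.IsCube n f ↔ X.IsCube n (g ∘ f)

/-- `g` acts without inversion: it maps no half-space to the opposite one. -/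
def NoInversion : Prop := ∀ H, X.IsHalfSpace H → g '' H ≠ Hᶜ

/-- The translation distance `min_v d(v, g v)`, in the combinatorial metric. -/
noncomputable def translationLength : ℕ := sInf (Set.range fun v => X.skeleton.dist v (g v))

/-- `g` is a hyperbolic automorphism: the group generated by `g` acts without inversion, and the
translation distance of `g` is positive. -/
structure IsHyperbolic : Prop where
  isAutomorphism : X.IsAutomorphism g
  noInversion : ∀ h ∈ Subgroup.zpowers g, X.NoInversion h
  pos : 0 < X.translationLength g

/-- `L` is a combinatorial axis of `g`: a bi-infinite geodesic on which `g` acts as the forward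
translation by the translation distance. -/
def IsAxis (L : ℤ → V) : Prop :=
  (∀ i j, (X.skeleton.dist (L i) (L j) : ℤ) = |i - j|) ∧
    ∀ i, g (L i) = L (i + X.translationLength g)

/-- The positive half-space axis of `g`: the half-spaces dual to a positively oriented edge of a
combinatorial axis of `g`. -/
def posAxis : Set (Set V) :=
  {H | X.IsHalfSpace H ∧ ∃ L, X.IsAxis g L ∧ ∃ i : ℤ, L i ∉ H ∧ L (i + 1) ∈ H}

/-- The full half-space axis of `g`. -/
def halfSpaceAxis : Set (Set V) := X.posAxis g ∪ {H | Hᶜ ∈ X.posAxis g}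

/-- The vertices of the minimal set of `g`. -/
def minSet : Set V := {v | X.skeleton.dist v (g v) = X.translationLength g}

end Automorphisms

section Sageev

variable {V : Type*} (A : Set (Set V))

/-- `σ` is an ultrafilter on the collection `A` of half-spaces: it contains exactly one half-space
of each pair `H, Hᶜ`, and no two of its elements are disjoint. -/
structure IsUltrafilter (σ : Set (Set V)) : Prop where
  subset : σ ⊆ A
  choice : ∀ H ∈ A, Xor (H ∈ σ) (Hᶜ ∈ σ)
  inter : ∀ H ∈ σ, ∀ K ∈ σ, (H ∩ K).Nonempty

/-- The ultrafilter on `A` defined by a vertex `v` of the ambient complex. -/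
def principal (v : V) : Set (Set V) := {H ∈ A | v ∈ H}

/-- The ultrafilters on `A` which serve as vertices of the Sageev construction: those which differ
from one defined by a vertex of the ambient complex on finitely many half-spaces. -/
def sageevVertices : Set (Set (Set V)) :=
  {σ | IsUltrafilter A σ ∧ ∃ v : V, (symmDiff σ (principal A v)).Finite}

/-- The ultrafilters `σ` and `τ` differ on exactly one pair `H, Hᶜ`. -/
def FlipAdj (σ τ : Set (Set V)) : Prop := ∃ H ∈ σ, Hᶜ ∉ σ ∧ τ = insert Hᶜ (σ \ {H})

/-- The Sageev construction on a collection `A` of half-spaces: vertices are the ultrafilters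
above, edges join ultrafilters that differ on a single hyperplane, and cubes are
added whenever their `1`-skeleta are present. -/
def sageev : CubeFamily (Set (Set V)) where
  IsCube _ f := (∀ x, f x ∈ sageevVertices A) ∧ Function.Injective f ∧
    ∀ x y, hammingDist x y = 1 → FlipAdj (f x) (f y)

/-- The half-spaces `{σ | H ∈ σ}` and `{σ | K ∈ σ}` of the Sageev construction on `A`, where
`H, K ∈ A`, are transverse: all four intersections of these half-spaces and their opposites are
non-empty. -/
def TransverseIn (H K : Set V) : Prop :=
  (∃ σ ∈ (sageev A).vertexSet, H ∈ σ ∧ K ∈ σ) ∧ (∃ σ ∈ (sageev A).vertexSet, H ∈ σ ∧ Kᶜ ∈ σ) ∧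
    (∃ σ ∈ (sageev A).vertexSet, Hᶜ ∈ σ ∧ K ∈ σ) ∧ ∃ σ ∈ (sageev A).vertexSet, Hᶜ ∈ σ ∧ Kᶜ ∈ σ

end Sageev

section Essential

variable {V : Type*} (X : CubeFamily V) (g : Equiv.Perm V)

/-- The essential characteristic set of `g`. -/
def essCharSet : CubeFamily (Set (Set V)) := sageev (X.halfSpaceAxis g)

/-- The essential minimal set of `g`: the projection to the essential characteristic set of the
minimal set of `g` (the full subcomplex of `X` on the vertices in `minSet`). The projection sends a
vertex to its ultrafilter on the half-space axis of `g`; the cubes of the essential minimal set are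
the cubes onto which cubes of the minimal set project. -/
def essMinSet : CubeFamily (Set (Set V)) where
  IsCube n f := (X.essCharSet g).IsCube n f ∧
    ∃ (m : ℕ) (c : (Fin m → Bool) → V), X.IsCube m c ∧ (∀ x, c x ∈ X.minSet g) ∧
      Set.range f = Set.range fun x => principal (X.halfSpaceAxis g) (c x)

/-- The group generated by an automorphism `h` (a power of `g`) acts non-transversely on the
essential characteristic set of `g`: no half-space `H` of that complex is transverse to `h H`. -/
def ActsNonTransversely (h : Equiv.Perm V) : Prop :=
  ∀ H ∈ X.halfSpaceAxis g, ¬ TransverseIn (X.halfSpaceAxis g) H (h '' H)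

end Essential

end CubeFamily

/-! Fix an axis `L` of `g` and let `lineSide L i` be the half-space entered by its `i`-th edge. Any
two axes are translated by `g` by the same amount and so cross the same hyperplanes in the same
direction. Hence A_g consists of the half-spaces `lineSide L i` and their complements, and `g`
shifts the index by ℓ, the translation distance of `g`. For a < b, three of the four intersections
of the sides of `lineSide L a` and `lineSide L b` contain vertices of `L`. The pair is therefore
transverse unless `lineSide L b ⊆ lineSide L a`. So statement 1 for k is the nesting condition
`lineSide L (i + kℓ) ⊆ lineSide L i` for all i, and the other statements are compared with it.

Nesting bounds the dimension by kℓ: the directions of a cube are pairwise transverse, while indices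
congruent modulo kℓ give nested half-spaces (`IsLine.finiteDimensional`). Conversely, pairwise
non-nested half-spaces span a cube (`IsLine.exists_isCube`). In dimension at most d, every i thus
admits some 0 < r ≤ d + 1 with `lineSide L (i + rℓ) ⊆ lineSide L i`, and k = (d + 1)! serves all i
(`IsAxis.exists_nested`).

For statement 2, vertices and cubes of the essential characteristic set lift to the convex hull of
`L` in X (`IsLine.exists_lift`, `IsLine.adj_of_flipAdj`, `IsCAT0.isCube_of_adj`). Under nesting, at
most one half-space per residue class modulo kℓ separates a hull vertex from its image under `g ^
k`, so hull vertices are moved minimally (`IsAxis.mem_minSet`). Conversely, the orbit of a minimally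
moved vertex lies on a geodesic, so by convexity it never leaves a half-space `lineSide L i` that it
has entered (`IsAxis.map_mem_lineSide`). If every vertex of the essential characteristic set is the
image of such a vertex, nesting follows.

The hyperplane theory of X is derived from flag links and simple connectivity. Paths modulo square
swaps satisfy Levi's lemma and have reductions invariant under homotopy, so geodesics with common
endpoints differ by square swaps. This gives the quadrangle condition, from which the needed facts
on half-spaces follow. Without an axis, A_g is empty and all three statements hold trivially. -/

namespace CubeFamily

/-! ### Squares and 3-cubes -/

section Squares

variable {V : Type*} {X : CubeFamily V} {a b c d : V}

theorem IsSquare.rotate (hX : X.IsCubeComplex) (h : X.IsSquare a b c d) : X.IsSquare b c d a := by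
  obtain ⟨f, hf, rfl, rfl, rfl, rfl⟩ := h
  refine ⟨f ∘ fun x => ![!(x 1), x 0], hX.face 2 f hf 2 _ ?_, ?_, ?_, ?_, ?_⟩
  · unfold IsFaceMap; decide
  all_goals simp

theorem IsSquare.reflect (hX : X.IsCubeComplex) (h : X.IsSquare a b c d) : X.IsSquare a d c b := by
  obtain ⟨f, hf, rfl, rfl, rfl, rfl⟩ := h
  refine ⟨f ∘ fun x => ![x 1, x 0], hX.face 2 f hf 2 _ ?_, ?_, ?_, ?_, ?_⟩
  · unfold IsFaceMap; decide
  all_goals simp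

theorem IsSquare.adj (hX : X.IsCubeComplex) (h : X.IsSquare a b c d) : X.skeleton.Adj a b := by
  obtain ⟨f, hf, rfl, rfl, rfl, rfl⟩ := h
  refine ⟨fun h => ?_, f ∘ fun x => ![x 0, false], hX.face 2 f hf 1 _ ?_, ?_⟩
  · have := congrFun (hX.injective 2 f hf h) 0
    simp at this
  · unfold IsFaceMap; decide
  · ext v
    simp only [Set.mem_range, Function.comp_apply, Set.mem_insert_iff, Set.mem_singleton_iff]
    constructor
    · rintro ⟨x, rfl⟩
      cases h : x 0 <;> simp
    · rintro (rfl | rfl)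
      · exact ⟨fun _ => false, rfl⟩
      · exact ⟨fun _ => true, rfl⟩

theorem IsSquare.ne_opposite (hX : X.IsCubeComplex) (h : X.IsSquare a b c d) : a ≠ c := by
  obtain ⟨f, hf, rfl, rfl, rfl, rfl⟩ := h
  intro h
  have := congrFun (hX.injective 2 f hf h) 0
  simp at this

theorem range_of_square (f : (Fin 2 → Bool) → V) :
    Set.range f = {f ![false, false], f ![true, false], f ![true, true], f ![false, true]} := by
  ext v
  simp only [Set.mem_range, Set.mem_insert_iff, Set.mem_singleton_iff]
  constructor
  · rintro ⟨x, rfl⟩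
    have hx : x = ![x 0, x 1] := by ext i; fin_cases i <;> rfl
    rw [hx]
    cases x 0 <;> cases x 1 <;> simp
  · rintro (rfl | rfl | rfl | rfl) <;> exact ⟨_, rfl⟩

theorem IsFaceMap.injective {k n : ℕ} {φ : (Fin k → Bool) → (Fin n → Bool)} (h : IsFaceMap φ) :
    Function.Injective φ := fun x y hxy => by
  have := h x y
  rw [hxy, hammingDist_self] at this
  exact hammingDist_eq_zero.1 this.symm

theorem IsSquare.rotateBack (hX : X.IsCubeComplex) (h : X.IsSquare a b c d) :
    X.IsSquare d a b c := ((h.rotate hX).rotate hX).rotate hX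

/-- A square is determined by three of its vertices. -/
theorem IsSquare.unique (hX : X.IsCubeComplex) {c' : V} (h : X.IsSquare a b c d)
    (h' : X.IsSquare a b c' d) : c = c' := by
  have hac := h.ne_opposite hX
  have hbd := (h.rotate hX).ne_opposite hX
  have hab := (h.adj hX).ne
  have hcb := ((h.rotate hX).adj hX).ne
  have hcd := ((h.rotate hX).rotate hX |>.adj hX).ne
  have hda := (((h.rotate hX).rotate hX).rotate hX |>.adj hX).ne
  obtain ⟨f, hf, rfl, rfl, rfl, rfl⟩ := h
  obtain ⟨f', hf', ha, hb, rfl, hd⟩ := h'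
  obtain ⟨k, φ, ψ, hφ, -, -, hr⟩ := hX.inter 2 f 2 f' hf hf' ⟨_, ⟨_, rfl⟩, ⟨_, ha⟩⟩
  have hcard : (Set.range f ∩ Set.range f').ncard = 2 ^ k := by
    rw [hr, ← Set.image_univ, Set.ncard_image_of_injective _ ((hX.injective _ _ hf).comp hφ.injective),
      Set.ncard_univ]
    simp
  have hcf : (Set.range f).ncard = 4 := by
    rw [← Set.image_univ, Set.ncard_image_of_injective _ (hX.injective _ _ hf), Set.ncard_univ]
    simp
  have h3 : 3 ≤ (Set.range f ∩ Set.range f').ncard := by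
    have : ({f ![false, false], f ![true, false], f ![false, true]} : Set V).ncard = 3 :=
      Set.ncard_eq_three.2 ⟨_, _, _, hab, hda.symm, hbd, rfl⟩
    rw [← this]
    refine Set.ncard_le_ncard ?_ ((Set.finite_range f).inter_of_left _)
    rintro v (rfl | rfl | rfl)
    exacts [⟨⟨_, rfl⟩, ⟨_, ha⟩⟩, ⟨⟨_, rfl⟩, ⟨_, hb⟩⟩, ⟨⟨_, rfl⟩, ⟨_, hd⟩⟩]
  -- The intersection is a common face and has 2^k vertices; three vertices force k ≥ 2, so it is
  -- the whole square.
  have hk : 4 ≤ (Set.range f ∩ Set.range f').ncard := by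
    rw [hcard] at h3 ⊢
    rcases k with _ | _ | k
    · simp at h3
    · simp at h3
    · rw [pow_add]; have := Nat.one_le_two_pow (n := k); omega
  have heq : Set.range f ∩ Set.range f' = Set.range f :=
    Set.eq_of_subset_of_ncard_le Set.inter_subset_left (by omega) (Set.finite_range f)
  have hmem : f ![true, true] ∈ Set.range f' := by
    have : f ![true, true] ∈ Set.range f ∩ Set.range f' := by
      rw [heq]; exact ⟨_, rfl⟩
    exact this.2
  rw [range_of_square, ha, hb, hd] at hmem
  rcases hmem with h | h | h | h
  · exact absurd h.symm hac
  · exact absurd h.symm hcb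
  · exact h
  · exact absurd h hcd

theorem IsSquare.spansCube (h : X.IsSquare a b c d) : X.SpansCube a ![b, d] := by
  obtain ⟨f, hf, rfl, rfl, rfl, rfl⟩ := h
  refine ⟨f, hf, ?_, ?_⟩
  · congr 1; ext i; fin_cases i <;> rfl
  · intro i
    fin_cases i
    · change f _ = f _
      congr 1; ext j; fin_cases j <;> rfl
    · change f _ = f _
      congr 1; ext j; fin_cases j <;> rfl

/-- Three squares at a vertex `o` that pairwise share an edge are faces of a `3`-cube. -/
theorem exists_cube_of_squares (hX : X.IsCubeComplex) (hF : X.FlagLinks) {o x y z xy xz yz : V}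
    (hxy : X.IsSquare o x xy y) (hxz : X.IsSquare o x xz z) (hyz : X.IsSquare o y yz z) :
    ∃ w, X.IsSquare x xy w xz ∧ X.IsSquare xy y yz w ∧ X.IsSquare xz z yz w := by
  have nxy := (hxy.rotate hX).ne_opposite hX
  have nxz := (hxz.rotate hX).ne_opposite hX
  have nyz := (hyz.rotate hX).ne_opposite hX
  obtain ⟨f, hf, h0, hi⟩ := hF o 3 ![x, y, z]
    (by
      intro i j hij
      fin_cases i <;> fin_cases j <;> simp_all [eq_comm])
    (by
      intro i
      fin_cases i
      exacts [hxy.adj hX, hyz.adj hX, (hyz.reflect hX).adj hX])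
    (by
      intro i j hij
      fin_cases i <;> fin_cases j
      · exact absurd rfl hij
      · exact hxy.spansCube
      · exact hxz.spansCube
      · exact (hxy.reflect hX).spansCube
      · exact absurd rfl hij
      · exact hyz.spansCube
      · exact (hxz.reflect hX).spansCube
      · exact (hyz.reflect hX).spansCube
      · exact absurd rfl hij)
  have hx : f ![true, false, false] = x := by
    rw [show x = ![x, y, z] 0 from rfl, ← hi 0]; congr 1; ext j; fin_cases j <;> rfl
  have hy : f ![false, true, false] = y := by
    rw [show y = ![x, y, z] 1 from rfl, ← hi 1]; congr 1; ext j; fin_cases j <;> rfl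
  have hz : f ![false, false, true] = z := by
    rw [show z = ![x, y, z] 2 from rfl, ← hi 2]; congr 1; ext j; fin_cases j <;> rfl
  have ho : f ![false, false, false] = o := by
    rw [← h0]; congr 1; ext j; fin_cases j <;> rfl
  have s12 : X.IsSquare o x (f ![true, true, false]) y :=
    ⟨f ∘ fun s => ![s 0, s 1, false], hX.face 3 f hf 2 _ (by unfold IsFaceMap; decide),
      by simpa using ho, by simpa using hx, by simp, by simpa using hy⟩
  have s13 : X.IsSquare o x (f ![true, false, true]) z :=
    ⟨f ∘ fun s => ![s 0, false, s 1], hX.face 3 f hf 2 _ (by unfold IsFaceMap; decide),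
      by simpa using ho, by simpa using hx, by simp, by simpa using hz⟩
  have s23 : X.IsSquare o y (f ![false, true, true]) z :=
    ⟨f ∘ fun s => ![false, s 0, s 1], hX.face 3 f hf 2 _ (by unfold IsFaceMap; decide),
      by simpa using ho, by simpa using hy, by simp, by simpa using hz⟩
  -- The flag condition controls only the neighbours of `o`; uniqueness of squares identifies the
  -- faces at `o` with the given ones.
  have e12 := s12.unique hX hxy
  have e13 := s13.unique hX hxz
  have e23 := s23.unique hX hyz
  refine ⟨f ![true, true, true], ?_, ?_, ?_⟩
  · exact ⟨f ∘ fun s => ![true, s 0, s 1], hX.face 3 f hf 2 _ (by unfold IsFaceMap; decide),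
      by simpa using hx, by simpa using e12, by simp, by simpa using e13⟩
  · exact ⟨f ∘ fun s => ![!(s 0), true, s 1], hX.face 3 f hf 2 _ (by unfold IsFaceMap; decide),
      by simpa using e12, by simpa using hy, by simpa using e23, by simp⟩
  · exact ⟨f ∘ fun s => ![!(s 0), s 1, true], hX.face 3 f hf 2 _ (by unfold IsFaceMap; decide),
      by simpa using e13, by simpa using hz, by simpa using e23, by simp⟩

end Squares

/-! ### Paths modulo square swaps: Levi's lemma and reduction -/

section Swaps

variable {V : Type*} (X : CubeFamily V)

/-- Pushing a path, given by the list of its vertices, across a square. -/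
inductive SquareSwap : List V → List V → Prop
  | head {a b c d : V} (h : X.IsSquare a b c d) (l : List V) :
      SquareSwap (a :: b :: c :: l) (a :: d :: c :: l)
  | cons (a : V) {l l' : List V} (h : SquareSwap l l') : SquareSwap (a :: l) (a :: l')

/-- Paths that differ by a sequence of square swaps. -/
def SwapEquiv : List V → List V → Prop := Relation.ReflTransGen X.SquareSwap

/-- The path backtracks along some edge. -/
inductive HasBacktrack : List V → Prop
  | head (a b : V) (l : List V) : HasBacktrack (a :: b :: a :: l)
  | cons (a : V) {l : List V} (h : HasBacktrack l) : HasBacktrack (a :: l)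

/-- No sequence of square swaps creates a backtracking. -/
def Reduced (l : List V) : Prop := ∀ l', X.SwapEquiv l l' → ¬ HasBacktrack l'

variable {X}

theorem SwapEquiv.refl (l : List V) : X.SwapEquiv l l := Relation.ReflTransGen.refl

theorem SwapEquiv.trans {l l' l'' : List V} (h : X.SwapEquiv l l') (h' : X.SwapEquiv l' l'') :
    X.SwapEquiv l l'' := Relation.ReflTransGen.trans h h'

theorem SquareSwap.symm (hX : X.IsCubeComplex) {l l' : List V} (h : X.SquareSwap l l') :
    X.SquareSwap l' l := by
  induction h with
  | head h l => exact .head (h.reflect hX) l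
  | cons a _ ih => exact .cons a ih

theorem SwapEquiv.symm (hX : X.IsCubeComplex) {l l' : List V} (h : X.SwapEquiv l l') :
    X.SwapEquiv l' l := by
  induction h with
  | refl => exact .refl _
  | tail _ h ih => exact (Relation.ReflTransGen.single (h.symm hX)).trans ih

theorem SwapEquiv.cons (a : V) {l l' : List V} (h : X.SwapEquiv l l') :
    X.SwapEquiv (a :: l) (a :: l') := by
  induction h with
  | refl => exact .refl _
  | tail _ h ih => exact ih.tail (.cons a h)

theorem SwapEquiv.swap {a b c d : V} (h : X.IsSquare a b c d) (l : List V) :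
    X.SwapEquiv (a :: b :: c :: l) (a :: d :: c :: l) := .single (.head h l)

theorem SquareSwap.length_eq {l l' : List V} (h : X.SquareSwap l l') : l.length = l'.length := by
  induction h <;> simp_all

theorem SwapEquiv.length_eq {l l' : List V} (h : X.SwapEquiv l l') : l.length = l'.length := by
  induction h with
  | refl => rfl
  | tail _ h ih => exact ih.trans h.length_eq

theorem SwapEquiv.head?_eq {l l' : List V} (h : X.SwapEquiv l l') : l.head? = l'.head? := by
  induction h with
  | refl => rfl
  | tail _ h ih => rw [ih]; cases h <;> rfl

theorem SwapEquiv.head_eq {a b : V} {l l' : List V} (h : X.SwapEquiv (a :: l) (b :: l')) :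
    a = b := by simpa using h.head?_eq

theorem SwapEquiv.exists_cons {a : V} {l m : List V} (h : X.SwapEquiv (a :: l) m) :
    ∃ l', m = a :: l' := by
  have := h.head?_eq
  cases m with
  | nil => simp at this
  | cons b l' => exact ⟨l', by simp at this; rw [this]⟩

theorem SquareSwap.getLast?_eq {l l' : List V} (h : X.SquareSwap l l') :
    l.getLast? = l'.getLast? := by
  induction h with
  | head h l => simp [List.getLast?_cons]
  | cons a _ ih => rw [List.getLast?_cons, List.getLast?_cons, ih]

theorem SwapEquiv.getLast?_eq {l l' : List V} (h : X.SwapEquiv l l') :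
    l.getLast? = l'.getLast? := by
  induction h with
  | refl => rfl
  | tail _ h ih => exact ih.trans h.getLast?_eq

theorem SquareSwap.isChain (hX : X.IsCubeComplex) {l l' : List V} (h : X.SquareSwap l l')
    (hl : l.IsChain X.skeleton.Adj) : l'.IsChain X.skeleton.Adj := by
  induction h with
  | head h l =>
    simp only [List.isChain_cons_cons] at hl ⊢
    exact ⟨(h.reflect hX).adj hX, ((h.reflect hX).rotate hX).adj hX, hl.2.2⟩
  | @cons a l l' h ih =>
    have hh : l.head? = l'.head? := SwapEquiv.head?_eq (.single h)
    rw [List.isChain_cons] at hl ⊢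
    exact ⟨by rw [← hh]; exact hl.1, ih hl.2⟩

theorem SwapEquiv.isChain (hX : X.IsCubeComplex) {l l' : List V} (h : X.SwapEquiv l l')
    (hl : l.IsChain X.skeleton.Adj) : l'.IsChain X.skeleton.Adj := by
  induction h with
  | refl => exact hl
  | tail _ h ih => exact h.isChain hX ih

/-- Either the paths `a :: l` and `a :: l'` share their first edge and the remainders are
equivalent, or their first edges span a square along which both can be continued. -/
def LeviRel (X : CubeFamily V) (a : V) (l l' : List V) : Prop :=
  X.SwapEquiv l l' ∨ ∃ b c d r, X.IsSquare a b c d ∧ X.SwapEquiv l (b :: c :: r) ∧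
    X.SwapEquiv l' (d :: c :: r)

/-- When both relations use a square, the two squares share the edge from `a` to `d`, and `ih`
compares the two continuations of `l₁` beyond `d`. Either the squares coincide, or a third square at
`d` completes them to a 3-cube; its face at `a` opposite to `d` is then the required square. -/
theorem LeviRel.trans (hX : X.IsCubeComplex) (hF : X.FlagLinks) {a : V} {l l₁ l₂ : List V}
    (ih : ∀ b r r', r.length < l₁.length → X.SwapEquiv (b :: r) (b :: r') → X.LeviRel b r r')
    (h : X.LeviRel a l l₁) (h' : X.LeviRel a l₁ l₂) : X.LeviRel a l l₂ := by
  rcases h with h | ⟨b, c, d, r, hs, hl, hl₁⟩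
  · rcases h' with h' | ⟨b, c, d, r, hs, hl, hl₁⟩
    · exact .inl (h.trans h')
    · exact .inr ⟨b, c, d, r, hs, h.trans hl, hl₁⟩
  rcases h' with h' | ⟨d', c', b', r', hs', hl', hl₂⟩
  · exact .inr ⟨b, c, d, r, hs, hl, (h'.symm hX).trans hl₁⟩
  have hm := (hl₁.symm hX).trans hl'
  obtain rfl := hm.head_eq
  rcases ih d (c :: r) (c' :: r') (by rw [hl₁.length_eq]; simp) hm with h | ⟨x, y, z, t, hs'', h1, h2⟩
  · obtain rfl := h.head_eq
    obtain rfl := ((hs'.reflect hX).rotateBack hX).unique hX (hs.rotateBack hX)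
    exact .inl ((hl.trans (h.cons _)).trans (hl₂.symm hX))
  · obtain rfl := h1.head_eq
    obtain rfl := h2.head_eq
    obtain ⟨w, w1, w2, w3⟩ := exists_cube_of_squares hX hF (o := d) (x := a) (y := c) (z := c')
      (xy := b) (xz := b') (yz := y)
      (hs.rotateBack hX) ((hs'.reflect hX).rotateBack hX) hs''
    refine .inr ⟨b, w, b', y :: t, w1, ?_, ?_⟩
    · exact hl.trans ((h1.cons b).trans (.swap w2 t))
    · exact hl₂.trans ((h2.cons b').trans (.swap w3 t))

/-- Levi's lemma for paths modulo square swaps. -/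
theorem SwapEquiv.leviRel (hX : X.IsCubeComplex) (hF : X.FlagLinks) {a : V} {l l' : List V}
    (h : X.SwapEquiv (a :: l) (a :: l')) : X.LeviRel a l l' := by
  induction hn : l.length using Nat.strong_induction_on generalizing a l l' with
  | _ n ih =>
    subst hn
    suffices H : ∀ m, X.SwapEquiv (a :: l) m → ∀ l', m = a :: l' → X.LeviRel a l l' from
      H _ h _ rfl
    intro m hm
    induction hm with
    | refl =>
      rintro l' h
      exact .inl (by rw [List.cons_injective h]; exact .refl _)
    | @tail m m' hm hs ih' =>
      rintro l' rfl
      obtain ⟨l₁, rfl⟩ := SwapEquiv.exists_cons hm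
      refine LeviRel.trans hX hF ?_ (ih' l₁ rfl) ?_
      · intro b r r' hr h
        refine ih _ ?_ h rfl
        have := SwapEquiv.length_eq hm
        simp at this
        omega
      · cases hs with
        | head h l => exact .inr ⟨_, _, _, _, h, .refl _, .refl _⟩
        | cons _ h => exact .inl (.single h)

/-- The square alternative in Levi's lemma requires different first edges, and here both are the
edge from `a` to `b`. -/
theorem SwapEquiv.cancel (hX : X.IsCubeComplex) (hF : X.FlagLinks) {a b : V} {l l' : List V}
    (h : X.SwapEquiv (a :: b :: l) (a :: b :: l')) : X.SwapEquiv (b :: l) (b :: l') := by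
  rcases h.leviRel hX hF with h | ⟨x, y, z, r, hs, h1, h2⟩
  · exact h
  · exact absurd (h1.head_eq.symm.trans h2.head_eq) ((hs.rotate hX).ne_opposite hX)

theorem Reduced.of_equiv {l l' : List V} (h : X.Reduced l) (h' : X.SwapEquiv l l') :
    X.Reduced l' := fun m hm => h m (h'.trans hm)

theorem Reduced.of_cons {a : V} {l : List V} (h : X.Reduced (a :: l)) : X.Reduced l :=
  fun m hm hb => h (a :: m) (hm.cons a) (.cons a hb)

theorem Reduced.not_backtrack {a b : V} {l m : List V} (h : X.Reduced l)
    (h' : X.SwapEquiv l (a :: b :: a :: m)) : False := h _ h' (.head a b m)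

/-- A reduced path can be prolonged by an edge to a reduced path unless it is equivalent to a path
that starts along that edge. -/
theorem Reduced.cons (hX : X.IsCubeComplex) (hF : X.FlagLinks) {a b : V} {l : List V}
    (h : X.Reduced (b :: l)) (ha : ∀ t, ¬ X.SwapEquiv (b :: l) (b :: a :: t)) :
    X.Reduced (a :: b :: l) := by
  induction hn : l.length using Nat.strong_induction_on generalizing a b l with
  | _ n ih =>
    subst hn
    intro q hq hb
    obtain ⟨q, rfl⟩ := hq.exists_cons
    have hlevi := hq.leviRel hX hF
    cases hb with
    | cons _ hb =>
      rcases hlevi with hl | ⟨b', c, d, r, hs, h1, h2⟩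
      · exact h _ hl hb
      obtain rfl := h1.head_eq
      have hcr : X.Reduced (c :: r) := (h.of_equiv h1).of_cons
      by_cases hc : ∃ t, X.SwapEquiv (c :: r) (c :: d :: t)
      · obtain ⟨t, ht⟩ := hc
        -- If `c :: r` could start with the edge to `d`, then pushing across the square would make
        -- `b :: l` start with the edge to `a`.
        exact ha _ (h1.trans ((ht.cons b).trans (.swap (hs.rotate hX) t)))
      · refine ih r.length ?_ hcr (fun t ht => hc ⟨t, ht⟩) rfl q (h2.symm hX) hb
        have := h1.length_eq
        simp at this
        omega
    | head _ y β =>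
      rcases hlevi with hl | ⟨b', c, d, r, hs, h1, h2⟩
      · obtain rfl := hl.head_eq
        exact ha _ hl
      obtain rfl := h1.head_eq
      obtain rfl := h2.head_eq
      rcases h2.leviRel hX hF with h3 | ⟨x, z, x', t, hs', h3, h4⟩
      · exact hs.ne_opposite hX h3.head_eq
      · obtain rfl := h3.head_eq
        obtain rfl := h4.head_eq
        -- The second square has the vertices of the first, so `b :: l` would itself be equivalent
        -- to a path backtracking along the edge from `b` to `c`.
        obtain rfl := hs'.unique hX (hs.rotateBack hX)
        exact h.not_backtrack (h1.trans (h4.cons _))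

open Classical in
/-- Prolong a reduced path by an edge and reduce. -/
noncomputable def reducedCons (X : CubeFamily V) (a : V) (r : List V) : List V :=
  if h : ∃ t b, X.SwapEquiv r (b :: a :: t) then a :: h.choose else a :: r

/-- The reduction of a path. -/
noncomputable def reduction (X : CubeFamily V) (l : List V) : List V := l.foldr X.reducedCons []

theorem reducedCons_cancel (hX : X.IsCubeComplex) (hF : X.FlagLinks) {a b : V} {r t : List V}
    (h : X.SwapEquiv r (b :: a :: t)) : X.SwapEquiv (X.reducedCons a r) (a :: t) := by
  have hex : ∃ t b, X.SwapEquiv r (b :: a :: t) := ⟨t, b, h⟩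
  rw [reducedCons, dif_pos hex]
  obtain ⟨b', h'⟩ := hex.choose_spec
  have := (h'.symm hX).trans h
  obtain rfl := this.head_eq
  exact this.cancel hX hF

theorem reducedCons_of_not {a : V} {r : List V} (h : ∀ b t, ¬ X.SwapEquiv r (b :: a :: t)) :
    X.reducedCons a r = a :: r := by
  rw [reducedCons, dif_neg]
  rintro ⟨t, b, h'⟩
  exact h b t h'

theorem reducedCons_eq {a : V} {r : List V} (h : X.Reduced (a :: r)) :
    X.reducedCons a r = a :: r :=
  reducedCons_of_not fun _ _ h' => h.not_backtrack (h'.cons a)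

theorem reducedCons_congr (hX : X.IsCubeComplex) (hF : X.FlagLinks) (a : V) {r r' : List V}
    (h : X.SwapEquiv r r') : X.SwapEquiv (X.reducedCons a r) (X.reducedCons a r') := by
  by_cases hr : ∃ b t, X.SwapEquiv r (b :: a :: t)
  · obtain ⟨b, t, ht⟩ := hr
    exact (reducedCons_cancel hX hF ht).trans
      ((reducedCons_cancel hX hF ((h.symm hX).trans ht)).symm hX)
  · push Not at hr
    rw [reducedCons_of_not hr, reducedCons_of_not fun b t ht => hr b t (h.trans ht)]
    exact h.cons a

theorem reducedCons_exists_cons (a : V) (r : List V) : ∃ t, X.reducedCons a r = a :: t := by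
  unfold reducedCons
  split_ifs <;> exact ⟨_, rfl⟩

theorem Reduced.reducedCons (hX : X.IsCubeComplex) (hF : X.FlagLinks) (a : V) {r : List V}
    (h : X.Reduced r) : X.Reduced (X.reducedCons a r) := by
  by_cases hr : ∃ b t, X.SwapEquiv r (b :: a :: t)
  · obtain ⟨b, t, ht⟩ := hr
    exact (h.of_equiv ht).of_cons.of_equiv ((reducedCons_cancel hX hF ht).symm hX)
  · push Not at hr
    rw [reducedCons_of_not hr]
    cases r with
    | nil =>
      intro l hl hb
      have := hl.length_eq
      cases hb with
      | head => simp at this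
      | cons _ hb => cases hb <;> simp at this
    | cons b l => exact h.cons hX hF (hr b)

theorem reduced_reduction (hX : X.IsCubeComplex) (hF : X.FlagLinks) (l : List V) :
    X.Reduced (X.reduction l) := by
  induction l with
  | nil =>
    intro l hl hb
    have := hl.length_eq
    cases hb <;> simp [reduction] at this
  | cons a l ih => exact ih.reducedCons hX hF a

theorem reduction_append_congr (hX : X.IsCubeComplex) (hF : X.FlagLinks) (l : List V)
    {m m' : List V} (h : X.SwapEquiv (X.reduction m) (X.reduction m')) :
    X.SwapEquiv (X.reduction (l ++ m)) (X.reduction (l ++ m')) := by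
  induction l with
  | nil => exact h
  | cons a l ih => exact reducedCons_congr hX hF a ih

theorem Reduced.reduction_eq {l : List V} (h : X.Reduced l) : X.reduction l = l := by
  induction l with
  | nil => rfl
  | cons a l ih =>
    change X.reducedCons a (X.reduction l) = _
    rw [ih h.of_cons, reducedCons_eq h]

/-- Either prepending `b` cancels an edge, which prepending `a` restores, or it prolongs the path,
and prepending `a` cancels the new edge. -/
theorem reduction_backtrack (hX : X.IsCubeComplex) (hF : X.FlagLinks) (a b : V) (l : List V) :
    X.SwapEquiv (X.reduction (a :: b :: a :: l)) (X.reduction (a :: l)) := by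
  obtain ⟨t, ht⟩ := reducedCons_exists_cons (X := X) a (X.reduction l)
  have hred := reduced_reduction hX hF (a :: l)
  change X.SwapEquiv (X.reducedCons a (X.reducedCons b (X.reducedCons a (X.reduction l))))
    (X.reducedCons a (X.reduction l))
  change X.Reduced (X.reducedCons a (X.reduction l)) at hred
  rw [ht] at hred ⊢
  by_cases hr : ∃ b' t', X.SwapEquiv (a :: t) (b' :: b :: t')
  · obtain ⟨b', t', h'⟩ := hr
    obtain rfl := h'.head_eq
    refine (reducedCons_congr hX hF a (reducedCons_cancel hX hF h')).trans ?_
    rw [reducedCons_eq (hred.of_equiv h')]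
    exact h'.symm hX
  · push Not at hr
    rw [reducedCons_of_not hr]
    exact reducedCons_cancel hX hF (.refl _)

/-- Via `b`, an edge is cancelled and then the edge from `a` to `b` is added. Via `d`, the path is
first prolonged, and pushing `d, c, b` to `d, a, b` shows that `a` then cancels. Both results are `a
:: b :: t`. -/
theorem reduction_square_aux (hX : X.IsCubeComplex) (hF : X.FlagLinks) {a b c d : V}
    (hs : X.IsSquare a b c d) {r t : List V}
    (hb : X.SwapEquiv (c :: r) (c :: b :: t))
    (hd : ∀ t, ¬ X.SwapEquiv (c :: r) (c :: d :: t)) :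
    X.SwapEquiv (X.reducedCons a (X.reducedCons b (c :: r)))
      (X.reducedCons a (X.reducedCons d (c :: r))) := by
  refine (reducedCons_congr hX hF a (reducedCons_cancel hX hF hb)).trans ?_
  have h1 : ∀ x s, ¬ X.SwapEquiv (b :: t) (x :: a :: s) := by
    intro x s h
    obtain rfl := h.head_eq
    exact hd _ (hb.trans ((h.cons c).trans (.swap ((hs.rotate hX).rotate hX |>.reflect hX) s)))
  rw [reducedCons_of_not h1, reducedCons_of_not (a := d)
    fun x s h => by obtain rfl := h.head_eq; exact hd _ h]
  refine ((reducedCons_cancel hX hF (b := d) ?_).symm hX)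
  exact (hb.cons d).trans (.swap (hs.rotateBack hX |>.reflect hX) t)

theorem reduction_square (hX : X.IsCubeComplex) (hF : X.FlagLinks) {a b c d : V}
    (hs : X.IsSquare a b c d) (l : List V) :
    X.SwapEquiv (X.reduction (a :: b :: c :: l)) (X.reduction (a :: d :: c :: l)) := by
  obtain ⟨r, hr⟩ := reducedCons_exists_cons (X := X) c (X.reduction l)
  have hred := reduced_reduction hX hF (c :: l)
  change X.SwapEquiv (X.reducedCons a (X.reducedCons b (X.reducedCons c (X.reduction l))))
    (X.reducedCons a (X.reducedCons d (X.reducedCons c (X.reduction l))))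
  change X.Reduced (X.reducedCons c (X.reduction l)) at hred
  rw [hr] at hred ⊢
  by_cases hb : ∃ t, X.SwapEquiv (c :: r) (c :: b :: t)
  · obtain ⟨t, hb⟩ := hb
    by_cases hd : ∃ t, X.SwapEquiv (c :: r) (c :: d :: t)
    · obtain ⟨t', hd⟩ := hd
      refine ((reducedCons_congr hX hF a (reducedCons_cancel hX hF hb)).trans ?_).trans
        ((reducedCons_congr hX hF a (reducedCons_cancel hX hF hd)).symm hX)
      rcases ((hb.symm hX).trans hd).leviRel hX hF with h | ⟨x, y, z, s, hs', h1, h2⟩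
      · exact absurd h.head_eq ((hs.rotate hX).ne_opposite hX)
      · obtain rfl := h1.head_eq
        obtain rfl := h2.head_eq
        -- Since both edges at `c` cancel, Levi's lemma yields a square at `c`, necessarily the
        -- given one; prepending `a` then cancels on both sides with the same remainder.
        obtain rfl := hs'.unique hX ((hs.reflect hX).rotate hX |>.rotate hX)
        exact (reducedCons_cancel hX hF h1).trans ((reducedCons_cancel hX hF h2).symm hX)
    · push Not at hd
      exact reduction_square_aux hX hF hs hb hd
  · push Not at hb
    by_cases hd : ∃ t, X.SwapEquiv (c :: r) (c :: d :: t)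
    · obtain ⟨t', hd⟩ := hd
      exact (reduction_square_aux hX hF (hs.reflect hX) hd hb).symm hX
    · push Not at hd
      rw [reducedCons_of_not (a := b) fun x s h => by obtain rfl := h.head_eq; exact hb _ h,
        reducedCons_of_not (a := d) fun x s h => by obtain rfl := h.head_eq; exact hd _ h]
      have key : ∀ {b d : V}, X.IsSquare a b c d → (∀ t, ¬ X.SwapEquiv (c :: r) (c :: d :: t)) →
          X.reducedCons a (b :: c :: r) = a :: b :: c :: r := by
        intro b d hs hd
        refine reducedCons_of_not fun x s h => ?_
        obtain rfl := h.head_eq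
        rcases h.leviRel hX hF with h | ⟨x, y, z, s', hs', h1, h2⟩
        · exact hs.ne_opposite hX h.head_eq.symm
        · obtain rfl := h1.head_eq
          obtain rfl := h2.head_eq
          obtain rfl := hs'.unique hX (hs.rotate hX)
          exact hd _ h1
      rw [key hs hd, key (hs.reflect hX) hb]
      exact .swap hs r

end Swaps

/-! ### Geodesics, parity and the quadrangle condition -/

section Geodesics

variable {V : Type*} {X : CubeFamily V}

theorem append_support {u v w : V} (p : X.skeleton.Walk u v) (q : X.skeleton.Walk v w) :
    (p.append q).support = p.support.dropLast ++ q.support := by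
  rw [SimpleGraph.Walk.support_append_eq_support_dropLast_append]

/-- Reduction works from the end of the path, so by `reduction_append_congr` the part before the
modification is irrelevant. -/
theorem ElementaryHomotopy.reduction_equiv (hX : X.IsCubeComplex) (hF : X.FlagLinks) {u v : V}
    {p q : X.skeleton.Walk u v} (h : X.ElementaryHomotopy p q) :
    X.SwapEquiv (X.reduction p.support) (X.reduction q.support) := by
  cases h with
  | backtrack p h q =>
    rw [append_support, append_support]
    refine reduction_append_congr hX hF _ ?_
    cases q <;> exact reduction_backtrack hX hF _ _ _
  | square hs p hab hbc had hdc q =>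
    rw [append_support, append_support]
    refine reduction_append_congr hX hF _ ?_
    cases q <;> exact reduction_square hX hF hs _

theorem homotopic_reduction_equiv (hX : X.IsCubeComplex) (hF : X.FlagLinks) {u v : V}
    {p q : X.skeleton.Walk u v} (h : Relation.EqvGen X.ElementaryHomotopy p q) :
    X.SwapEquiv (X.reduction p.support) (X.reduction q.support) := by
  induction h with
  | rel _ _ h => exact h.reduction_equiv hX hF
  | refl => exact .refl _
  | symm _ _ _ ih => exact ih.symm hX
  | trans _ _ _ _ _ ih ih' => exact ih.trans ih'

theorem ElementaryHomotopy.append {u v w : V} {p q : X.skeleton.Walk u v}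
    (h : X.ElementaryHomotopy p q) (r : X.skeleton.Walk v w) :
    X.ElementaryHomotopy (p.append r) (q.append r) := by
  cases h with
  | backtrack p h q =>
    rw [← SimpleGraph.Walk.append_assoc, ← SimpleGraph.Walk.append_assoc]
    exact .backtrack p h (q.append r)
  | square hs p hab hbc had hdc q =>
    rw [← SimpleGraph.Walk.append_assoc, ← SimpleGraph.Walk.append_assoc]
    exact .square hs p hab hbc had hdc (q.append r)

theorem homotopic_append {u v w : V} {p q : X.skeleton.Walk u v}
    (h : Relation.EqvGen X.ElementaryHomotopy p q) (r : X.skeleton.Walk v w) :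
    Relation.EqvGen X.ElementaryHomotopy (p.append r) (q.append r) := by
  induction h with
  | rel _ _ h => exact .rel _ _ (h.append r)
  | refl => exact .refl _
  | symm _ _ _ ih => exact ih.symm
  | trans _ _ _ _ _ ih ih' => exact ih.trans _ _ _ ih'

theorem homotopic_append_reverse {u v w : V} (p : X.skeleton.Walk u v) (q : X.skeleton.Walk w v) :
    Relation.EqvGen X.ElementaryHomotopy (p.append (q.reverse.append q)) p := by
  induction q with
  | nil => simpa using .refl _
  | cons h q ih =>
    refine .trans _ _ _ ?_ (ih p)
    simp only [SimpleGraph.Walk.reverse_cons]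
    have := ElementaryHomotopy.backtrack (p.append q.reverse) h.symm q
    rw [← SimpleGraph.Walk.append_assoc] at this
    rw [← SimpleGraph.Walk.append_assoc p q.reverse q] at this
    rw [← SimpleGraph.Walk.append_assoc q.reverse]
    exact .rel _ _ this

/-- Any two paths with the same endpoints have the same reduction up to square swaps. -/
theorem IsCAT0.reduction_equiv (hX : X.IsCAT0) {u v : V} (p q : X.skeleton.Walk u v) :
    X.SwapEquiv (X.reduction p.support) (X.reduction q.support) := by
  refine homotopic_reduction_equiv hX.1 hX.2 ?_
  have h1 := homotopic_append_reverse p q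
  have h2 := homotopic_append (hX.3.2 u (p.append q.reverse)) q
  rw [← SimpleGraph.Walk.append_assoc] at h2
  exact .trans _ _ _ (.symm _ _ h1) h2

theorem exists_walk_of_isChain {l : List V} {a b : V} (hl : (a :: l).IsChain X.skeleton.Adj)
    (hb : (a :: l).getLast? = some b) :
    ∃ p : X.skeleton.Walk a b, p.length = l.length := by
  induction l generalizing a with
  | nil =>
    simp at hb
    subst hb
    exact ⟨.nil, rfl⟩
  | cons c l ih =>
    rw [List.isChain_cons_cons] at hl
    obtain ⟨p, hp⟩ := ih hl.2 (by simpa [List.getLast?_cons] using hb)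
    exact ⟨.cons hl.1 p, by simp [hp]⟩

theorem HasBacktrack.exists_shorter {l : List V} (hb : HasBacktrack l)
    (hl : l.IsChain X.skeleton.Adj) :
    ∃ m : List V, m.IsChain X.skeleton.Adj ∧ m.head? = l.head? ∧ m.getLast? = l.getLast? ∧
      m.length < l.length := by
  induction hb with
  | head a b l =>
    refine ⟨a :: l, ?_, rfl, by simp [List.getLast?_cons], by simp⟩
    exact (List.isChain_cons_cons.1 (List.isChain_cons_cons.1 hl).2).2
  | @cons a l hb ih =>
    rw [List.isChain_cons] at hl
    obtain ⟨m, h1, h2, h3, h4⟩ := ih hl.2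
    refine ⟨a :: m, ?_, rfl, by rw [List.getLast?_cons, List.getLast?_cons, h3], by simpa⟩
    rw [List.isChain_cons, h2]
    exact ⟨hl.1, h1⟩

/-- Swaps preserve length and endpoints, so a backtracking created by them would yield a path
shorter than the distance. -/
theorem reduced_of_length_eq_dist (hX : X.IsCubeComplex) {u v : V} (p : X.skeleton.Walk u v)
    (hp : p.length = X.skeleton.dist u v) : X.Reduced p.support := by
  intro l hl hb
  have hc := hl.isChain hX p.isChain_adj_support
  obtain ⟨m, h1, h2, h3, h4⟩ := hb.exists_shorter hc
  rw [← hl.length_eq, p.length_support] at h4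
  rw [← hl.head?_eq] at h2
  rw [← hl.getLast?_eq] at h3
  rw [List.head?_eq_some_head p.support_ne_nil, p.head_support] at h2
  rw [List.getLast?_eq_some_getLast p.support_ne_nil, p.getLast_support] at h3
  cases m with
  | nil => simp at h2
  | cons a m =>
    simp at h2
    subst h2
    obtain ⟨q, hq⟩ := exists_walk_of_isChain h1 h3
    have := SimpleGraph.dist_le q
    simp at h4
    omega

theorem IsCAT0.geodesic_equiv (hX : X.IsCAT0) {u v : V} (p q : X.skeleton.Walk u v)
    (hp : p.length = X.skeleton.dist u v) (hq : q.length = X.skeleton.dist u v) :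
    X.SwapEquiv p.support q.support := by
  have := hX.reduction_equiv p q
  rwa [(reduced_of_length_eq_dist hX.1 p hp).reduction_eq,
    (reduced_of_length_eq_dist hX.1 q hq).reduction_eq] at this

theorem ElementaryHomotopy.length_mod_two {u v : V} {p q : X.skeleton.Walk u v}
    (h : X.ElementaryHomotopy p q) : p.length % 2 = q.length % 2 := by
  cases h <;> simp only [SimpleGraph.Walk.length_append, SimpleGraph.Walk.length_cons]
  omega

/-- Elementary homotopies preserve the parity of the length, and every closed path is
null-homotopic. -/
theorem IsCAT0.closed_even (hX : X.IsCAT0) {u : V} (p : X.skeleton.Walk u u) :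
    p.length % 2 = 0 := by
  have h : ∀ {v : V} {p q : X.skeleton.Walk u v}, Relation.EqvGen X.ElementaryHomotopy p q →
      p.length % 2 = q.length % 2 := by
    intro v p q h
    induction h with
    | rel _ _ h => exact h.length_mod_two
    | refl => rfl
    | symm _ _ _ ih => exact ih.symm
    | trans _ _ _ _ _ ih ih' => exact ih.trans ih'
  exact h (hX.3.2 u p)

/-- The `1`-skeleton is bipartite. -/
theorem IsCAT0.dist_adj (hX : X.IsCAT0) (x : V) {a b : V} (h : X.skeleton.Adj a b) :
    X.skeleton.dist x a = X.skeleton.dist x b + 1 ∨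
      X.skeleton.dist x b = X.skeleton.dist x a + 1 := by
  obtain ⟨p, hp⟩ := hX.3.1.exists_walk_length_eq_dist x a
  obtain ⟨q, hq⟩ := hX.3.1.exists_walk_length_eq_dist x b
  have h1 := hX.closed_even (p.append (.cons h q.reverse))
  simp only [SimpleGraph.Walk.length_append, SimpleGraph.Walk.length_cons,
    SimpleGraph.Walk.length_reverse, hp, hq] at h1
  have h2 := SimpleGraph.dist_le (p.append (.cons h .nil))
  have h3 := SimpleGraph.dist_le (q.append (.cons h.symm .nil))
  simp [hp, hq] at h2 h3
  omega

/-- The quadrangle condition. -/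
theorem IsCAT0.quadrangle (hX : X.IsCAT0) {x a b c : V} (hab : X.skeleton.Adj b a)
    (hcb : X.skeleton.Adj b c) (hac : a ≠ c)
    (ha : X.skeleton.dist b x = X.skeleton.dist a x + 1)
    (hc : X.skeleton.dist b x = X.skeleton.dist c x + 1) :
    ∃ z, X.IsSquare b a z c ∧ X.skeleton.dist a x = X.skeleton.dist z x + 1 := by
  obtain ⟨p, hp⟩ := hX.3.1.exists_walk_length_eq_dist a x
  obtain ⟨q, hq⟩ := hX.3.1.exists_walk_length_eq_dist c x
  -- Two geodesics from `b` to `x` with different first edges: Levi's lemma produces the square.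
  have h := hX.geodesic_equiv (.cons hab p) (.cons hcb q) (by simp; omega) (by simp; omega)
  rw [SimpleGraph.Walk.support_cons, SimpleGraph.Walk.support_cons] at h
  have hpc := p.isChain_adj_support
  have hpl := List.getLast?_eq_some_getLast p.support_ne_nil
  rw [p.getLast_support] at hpl
  have hlen := p.length_support
  have hpa : p.support = a :: p.support.tail := by cases p <;> rfl
  have hqc : q.support = c :: q.support.tail := by cases q <;> rfl
  rcases h.leviRel hX.1 hX.2 with h | ⟨a', z, c', r, hs, h1, h2⟩
  · rw [hpa, hqc] at h
    exact absurd h.head_eq hac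
  · rw [h1.length_eq] at hlen
    have hch := h1.isChain hX.1 hpc
    rw [h1.getLast?_eq] at hpl
    rw [hpa] at h1
    rw [hqc] at h2
    obtain rfl := h1.head_eq
    obtain rfl := h2.head_eq
    refine ⟨z, hs, ?_⟩
    rw [List.isChain_cons_cons] at hch
    obtain ⟨w, hw⟩ := exists_walk_of_isChain hch.2 (b := x)
      (by simpa [List.getLast?_cons] using hpl)
    have h3 := SimpleGraph.dist_le w
    have h4 := SimpleGraph.dist_le (SimpleGraph.Walk.cons hch.1
      (hX.3.1.exists_walk_length_eq_dist z x).choose)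
    have h5 := (hX.3.1.exists_walk_length_eq_dist z x).choose_spec
    simp only [SimpleGraph.Walk.length_cons, h5] at h4
    simp at hlen
    omega

end Geodesics

/-! ### Half-spaces as sides of edges; separation, convexity, gates -/

section HalfSpaces

variable {V : Type*} {X : CubeFamily V}

/-- The vertices closer to `a` than to `b`. -/
def side (X : CubeFamily V) (a b : V) : Set V := {x | X.skeleton.dist x a < X.skeleton.dist x b}

theorem mem_side {a b x : V} : x ∈ X.side a b ↔ X.skeleton.dist x a < X.skeleton.dist x b := Iff.rfl

theorem left_mem_side {a b : V} (h : X.skeleton.Adj a b) : a ∈ X.side a b := by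
  rw [mem_side, SimpleGraph.dist_self, SimpleGraph.dist_eq_one_iff_adj.2 h]
  exact one_pos

theorem right_notMem_side (a b : V) : b ∉ X.side a b := by
  rw [mem_side, SimpleGraph.dist_self]
  exact Nat.not_lt_zero _

theorem IsCAT0.compl_side (hX : X.IsCAT0) {a b : V} (h : X.skeleton.Adj a b) :
    (X.side a b)ᶜ = X.side b a := by
  ext x
  rw [Set.mem_compl_iff, mem_side, mem_side]
  have := hX.dist_adj x h
  omega

/-- Otherwise parity puts `a` and `c` at equal distance from `x`, with `b` and `d` both one further
away. The quadrangle condition at `b` then completes the square by a vertex nearer to `x`, which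
must be `d`. -/
theorem IsCAT0.side_subset_of_isSquare (hX : X.IsCAT0) {a b c d : V} (h : X.IsSquare a b c d) :
    X.side a b ⊆ X.side d c := by
  intro x hx
  by_contra hx'
  rw [mem_side] at hx hx'
  have h1 := hX.dist_adj x (h.adj hX.1)
  have h2 := hX.dist_adj x ((h.rotate hX.1).adj hX.1)
  have h3 := hX.dist_adj x ((h.reflect hX.1).adj hX.1)
  have h4 := hX.dist_adj x (((h.rotate hX.1).rotate hX.1).adj hX.1)
  have hs := (h.reflect hX.1).rotateBack hX.1
  obtain ⟨z, hz, hz'⟩ := hX.quadrangle (x := x) (hs.adj hX.1) ((hs.reflect hX.1).adj hX.1)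
    (h.ne_opposite hX.1) (by simp only [SimpleGraph.dist_comm (v := x)]; omega)
    (by simp only [SimpleGraph.dist_comm (v := x)]; omega)
  obtain rfl := hz.unique hX.1 hs
  simp only [SimpleGraph.dist_comm (v := x)] at hz'
  omega

theorem IsCAT0.side_eq_of_isSquare (hX : X.IsCAT0) {a b c d : V} (h : X.IsSquare a b c d) :
    X.side a b = X.side d c :=
  (hX.side_subset_of_isSquare h).antisymm
    (hX.side_subset_of_isSquare ((h.reflect hX.1).rotate hX.1))

theorem IsCAT0.exists_adj_closer (hX : X.IsCAT0) {u x : V} (h : u ≠ x) :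
    ∃ w, X.skeleton.Adj u w ∧ X.skeleton.dist u x = X.skeleton.dist w x + 1 := by
  obtain ⟨p, hp⟩ := hX.3.1.exists_walk_length_eq_dist u x
  cases p with
  | nil => exact absurd rfl h
  | @cons _ w _ hw q =>
    refine ⟨w, hw, ?_⟩
    have h1 := SimpleGraph.dist_le q
    have h2 := hX.dist_adj x hw
    simp only [SimpleGraph.dist_comm (u := x)] at h2
    simp at hp
    omega

/-- An edge joining the two sides of an edge is parallel to it. -/
theorem IsCAT0.parallel_of_mem_side (hX : X.IsCAT0) {a b u v : V} (hab : X.skeleton.Adj a b)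
    (huv : X.skeleton.Adj u v) (hu : u ∈ X.side a b) (hv : v ∈ X.side b a) :
    X.Parallel s(a, b) s(u, v) ∧ X.side a b = X.side u v := by
  induction hn : X.skeleton.dist u a generalizing u v with
  | zero =>
    obtain rfl := hX.3.1.dist_eq_zero_iff.1 hn
    rw [mem_side, SimpleGraph.dist_comm (v := u), SimpleGraph.dist_eq_one_iff_adj.2 huv,
      Nat.lt_one_iff] at hv
    obtain rfl := hX.3.1.dist_eq_zero_iff.1 hv
    exact ⟨.refl _, rfl⟩
  | succ n ih =>
    rw [mem_side] at hu hv
    have h1 := hX.dist_adj u hab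
    have h2 := hX.dist_adj v hab
    have h3 := hX.dist_adj a huv
    have h4 := hX.dist_adj b huv
    simp only [SimpleGraph.dist_comm (u := a), SimpleGraph.dist_comm (u := b)] at h3 h4
    obtain ⟨w, hw, hwb⟩ := hX.exists_adj_closer (u := v) (x := b) (by
      rintro rfl
      rw [SimpleGraph.dist_self] at h4
      omega)
    have h5 := hX.dist_adj w hab
    have h6 := hX.dist_adj a hw
    simp only [SimpleGraph.dist_comm (u := a)] at h6
    -- Both `u` and `w` are nearer to `a` than `v` is, so the edge from `u` to `v` is opposite in a
    -- square to an edge from `z` to `w` that also joins the two sides and is nearer to `a`.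
    obtain ⟨z, hz, hza⟩ := hX.quadrangle (x := a) huv.symm hw
      (by rintro rfl; omega) (by omega) (by omega)
    have h7 := hX.dist_adj z hab
    have h8 := hX.dist_adj b ((hz.rotate hX.1).adj hX.1)
    simp only [SimpleGraph.dist_comm (u := b)] at h8
    obtain ⟨i1, i2⟩ := ih (((hz.rotate hX.1).rotate hX.1).adj hX.1)
      (by rw [mem_side]; omega) (by rw [mem_side]; omega) (by omega)
    refine ⟨i1.trans _ _ _ (.symm _ _ (.rel _ _ ⟨v, u, z, w, hz, ?_, ?_⟩)), i2.trans
      (hX.side_eq_of_isSquare ((hz.reflect hX.1).rotateBack hX.1)).symm⟩ <;> exact Sym2.eq_swap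

theorem IsCAT0.side_eq_of_parallel (hX : X.IsCAT0) {a b u v : V}
    (h : X.Parallel s(a, b) s(u, v)) : X.side a b = X.side u v ∨ X.side a b = X.side v u := by
  let sides : Sym2 V → Set (Set V) := fun e => {H | ∃ a b, e = s(a, b) ∧ H = X.side a b}
  have hsides : ∀ a b, sides s(a, b) = {X.side a b, X.side b a} := by
    intro a b
    ext H
    simp only [sides, Set.mem_ofPred_eq, Sym2.eq_iff, Set.mem_insert_iff, Set.mem_singleton_iff]
    constructor
    · rintro ⟨x, y, ⟨rfl, rfl⟩ | ⟨rfl, rfl⟩, rfl⟩ <;> simp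
    · rintro (rfl | rfl)
      exacts [⟨a, b, .inl ⟨rfl, rfl⟩, rfl⟩, ⟨b, a, .inr ⟨rfl, rfl⟩, rfl⟩]
  have key : ∀ e e', X.Parallel e e' → sides e = sides e' := by
    intro e e' h
    induction h with
    | rel _ _ h =>
      obtain ⟨a, b, c, d, hs, rfl, rfl⟩ := h
      rw [hsides, hsides, hX.side_eq_of_isSquare hs,
        hX.side_eq_of_isSquare ((hs.reflect hX.1).rotateBack hX.1)]
    | refl => rfl
    | symm _ _ _ ih => exact ih.symm
    | trans _ _ _ _ _ ih ih' => exact ih.trans ih'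
  have := key _ _ h
  rw [hsides, hsides] at this
  have h' : X.side a b ∈ ({X.side u v, X.side v u} : Set (Set V)) := this ▸ Set.mem_insert _ _
  simpa using h'

/-- A geodesic to `a` from its side stays there and uses no parallel edge; conversely, an edge
leaving the side is parallel to the given one. -/
theorem IsCAT0.reachable_eq_side (hX : X.IsCAT0) {a b v : V} (hab : X.skeleton.Adj a b)
    (hv : v ∈ X.side a b) :
    {w | (X.skeleton.deleteEdges {e' | X.Parallel s(a, b) e'}).Reachable v w} = X.side a b := by
  have hr : ∀ w ∈ X.side a b,
      (X.skeleton.deleteEdges {e' | X.Parallel s(a, b) e'}).Reachable w a := by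
    intro w hw
    induction hn : X.skeleton.dist w a generalizing w with
    | zero => rw [hX.3.1.dist_eq_zero_iff.1 hn]
    | succ n ih =>
      obtain ⟨y, hy, hy'⟩ := hX.exists_adj_closer (u := w) (x := a) (by
        rintro rfl
        simp at hn)
      have hyb := hX.dist_adj b hy
      simp only [SimpleGraph.dist_comm (u := b)] at hyb
      have hys : y ∈ X.side a b := by
        rw [mem_side] at hw ⊢
        omega
      refine SimpleGraph.Reachable.trans (SimpleGraph.Adj.reachable ?_) (ih y hys (by omega))
      rw [SimpleGraph.deleteEdges_adj]
      refine ⟨hy, fun hp => ?_⟩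
      rcases hX.side_eq_of_parallel hp with h | h
      · exact right_notMem_side w y (h ▸ hys)
      · exact right_notMem_side y w (h ▸ hw)
  ext w
  constructor
  · rintro ⟨p⟩
    induction p with
    | nil => exact hv
    | cons h p ih =>
      refine ih ?_
      rw [SimpleGraph.deleteEdges_adj] at h
      by_contra hn
      rw [← Set.mem_compl_iff, hX.compl_side hab] at hn
      exact h.2 (hX.parallel_of_mem_side hab h.1 hv hn).1
  · intro hw
    exact (hr v hv).trans (hr w hw).symm

theorem IsCAT0.isHalfSpace_iff (hX : X.IsCAT0) {H : Set V} :
    X.IsHalfSpace H ↔ ∃ a b, X.skeleton.Adj a b ∧ H = X.side a b := by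
  constructor
  · rintro ⟨e, he, v, rfl⟩
    induction e with
    | _ a b =>
    rw [SimpleGraph.mem_edgeSet] at he
    by_cases hv : v ∈ X.side a b
    · exact ⟨a, b, he, hX.reachable_eq_side he hv⟩
    · rw [← Set.mem_compl_iff, hX.compl_side he] at hv
      refine ⟨b, a, he.symm, ?_⟩
      rw [← hX.reachable_eq_side he.symm hv, Sym2.eq_swap]
  · rintro ⟨a, b, h, rfl⟩
    exact ⟨s(a, b), h, a, (hX.reachable_eq_side h (left_mem_side h)).symm⟩

theorem IsCAT0.isHalfSpace_side (hX : X.IsCAT0) {a b : V} (h : X.skeleton.Adj a b) :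
    X.IsHalfSpace (X.side a b) := hX.isHalfSpace_iff.2 ⟨a, b, h, rfl⟩

theorem IsCAT0.isHalfSpace_compl (hX : X.IsCAT0) {H : Set V} (h : X.IsHalfSpace H) :
    X.IsHalfSpace Hᶜ := by
  obtain ⟨a, b, hab, rfl⟩ := hX.isHalfSpace_iff.1 h
  rw [hX.compl_side hab]
  exact hX.isHalfSpace_side hab.symm

theorem IsCAT0.eq_side (hX : X.IsCAT0) {H : Set V} (hH : X.IsHalfSpace H) {u v : V}
    (h : X.skeleton.Adj u v) (hu : u ∈ H) (hv : v ∉ H) : H = X.side u v := by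
  obtain ⟨a, b, hab, rfl⟩ := hX.isHalfSpace_iff.1 hH
  rw [← Set.mem_compl_iff, hX.compl_side hab] at hv
  exact (hX.parallel_of_mem_side hab h hu hv).2

/-- The half-spaces that contain `y` but not `x`. -/
def separators (X : CubeFamily V) (x y : V) : Set (Set V) := {H | X.IsHalfSpace H ∧ x ∉ H ∧ y ∈ H}

/-- The first edge of a geodesic crosses exactly one hyperplane, and no half-space is entered twice.
-/
theorem IsCAT0.separators_finite_and_ncard (hX : X.IsCAT0) (x y : V) :
    (X.separators x y).Finite ∧ (X.separators x y).ncard = X.skeleton.dist x y := by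
  induction hn : X.skeleton.dist x y generalizing x with
  | zero =>
    obtain rfl := hX.3.1.dist_eq_zero_iff.1 hn
    have : X.separators x x = ∅ := by
      ext H
      simp [separators]
    rw [this]
    simp
  | succ n ih =>
    obtain ⟨w, hw, hwy⟩ := hX.exists_adj_closer (u := x) (x := y) (by
      rintro rfl
      simp at hn)
    obtain ⟨i1, i2⟩ := ih w (by omega)
    have hy : y ∈ X.side w x := by
      rw [mem_side, SimpleGraph.dist_comm (v := w), SimpleGraph.dist_comm (v := x)]
      omega
    have heq : X.separators x y = insert (X.side w x) (X.separators w y) := by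
      ext H
      rw [Set.mem_insert_iff]
      constructor
      · rintro ⟨h1, h2, h3⟩
        by_cases hwH : w ∈ H
        · exact .inl (hX.eq_side h1 hw.symm hwH h2)
        · exact .inr ⟨h1, hwH, h3⟩
      · rintro (rfl | ⟨h1, h2, h3⟩)
        · exact ⟨hX.isHalfSpace_side hw.symm, right_notMem_side _ _, hy⟩
        · refine ⟨h1, fun hx => ?_, h3⟩
          rw [hX.eq_side h1 hw hx h2, ← hX.compl_side hw.symm] at h3
          exact h3 hy
    have hni : X.side w x ∉ X.separators w y := fun h => h.2.1 (left_mem_side hw.symm)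
    rw [heq, Set.ncard_insert_of_notMem hni i1, i2]
    exact ⟨i1.insert _, rfl⟩

theorem IsCAT0.finite_separators (hX : X.IsCAT0) (x y : V) : (X.separators x y).Finite :=
  (hX.separators_finite_and_ncard x y).1

theorem IsCAT0.ncard_separators (hX : X.IsCAT0) (x y : V) :
    (X.separators x y).ncard = X.skeleton.dist x y := (hX.separators_finite_and_ncard x y).2

/-- Half-spaces are convex. -/
theorem IsCAT0.convex (hX : X.IsCAT0) {H : Set V} (hH : X.IsHalfSpace H) {x y z : V} (hx : x ∈ H)
    (hy : y ∈ H) (hz : X.skeleton.dist x z + X.skeleton.dist z y = X.skeleton.dist x y) :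
    z ∈ H := by
  by_contra hzH
  have h1 : X.separators x y ⊆ (X.separators x z) ∪ (X.separators z y \ {H}) := by
    rintro K ⟨hK, hKx, hKy⟩
    by_cases hKz : z ∈ K
    · exact .inl ⟨hK, hKx, hKz⟩
    · refine .inr ⟨⟨hK, hKz, hKy⟩, ?_⟩
      rintro rfl
      exact hKx hx
  have h2 := Set.ncard_le_ncard h1 ((hX.finite_separators _ _).union (hX.finite_separators _ _).sdiff)
  have h3 := Set.ncard_union_le (X.separators x z) (X.separators z y \ {H})
  have h4 := Set.ncard_sdiff_singleton_lt_of_mem (s := X.separators z y) (a := H) ⟨hH, hzH, hy⟩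
    (hX.finite_separators _ _)
  rw [hX.ncard_separators] at h2 h3 h4
  omega

/-- A point of a half-space closest to a vertex outside is a gate. -/
theorem IsCAT0.gate (hX : X.IsCAT0) {H : Set V} (hH : X.IsHalfSpace H) {v m : V} (hm : m ∈ H)
    (hmin : ∀ u ∈ H, X.skeleton.dist v m ≤ X.skeleton.dist v u) {w : V} (hw : w ∈ H) :
    X.skeleton.dist v w = X.skeleton.dist v m + X.skeleton.dist m w := by
  induction hn : X.skeleton.dist m w using Nat.strong_induction_on generalizing w with
  | _ n ih =>
    subst hn
    by_cases hwm : w = m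
    · subst hwm
      simp
    obtain ⟨w₁, h₁, hd₁⟩ := hX.exists_adj_closer hwm
    have hone := SimpleGraph.dist_eq_one_iff_adj.2 h₁.symm
    have hd₁' := hd₁
    rw [SimpleGraph.dist_comm (v := m), SimpleGraph.dist_comm (v := m)] at hd₁'
    have hw₁ : w₁ ∈ H := hX.convex hH hm hw (by omega)
    have i₁ := ih _ (by omega) hw₁ rfl
    rcases hX.dist_adj v h₁ with h | h
    · omega
    by_cases hwm₁ : w₁ = m
    · subst hwm₁
      have := hmin w hw
      omega
    obtain ⟨w₂, h₂, hd₂⟩ := hX.exists_adj_closer hwm₁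
    have hone₂ := SimpleGraph.dist_eq_one_iff_adj.2 h₂.symm
    have hd₂' := hd₂
    rw [SimpleGraph.dist_comm (v := m), SimpleGraph.dist_comm (v := m)] at hd₂'
    have hw₂ : w₂ ∈ H := hX.convex hH hm hw₁ (by omega)
    have i₂ := ih _ (by omega) hw₂ rfl
    obtain ⟨z, hz, hzv⟩ := hX.quadrangle (x := v) h₁.symm h₂ (by rintro rfl; omega)
      (by rw [SimpleGraph.dist_comm (v := v), SimpleGraph.dist_comm (v := v)]; omega)
      (by rw [SimpleGraph.dist_comm (v := v), SimpleGraph.dist_comm (v := v)]; omega)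
    -- In the remaining case `w` is nearer to `v` than `w₁`. Opposite edges of the square have equal
    -- sides, which puts `z` between `m` and `w`, hence in `H`; the induction hypothesis at `z` then
    -- contradicts its distance to `v`.
    have hside : m ∈ X.side w₂ z := by
      rw [← hX.side_eq_of_isSquare hz, mem_side]
      omega
    have hadj := ((hz.rotate hX.1).rotate hX.1).adj hX.1
    have hdz := hX.dist_adj m hadj
    rw [mem_side] at hside
    have hone₃ := SimpleGraph.dist_eq_one_iff_adj.2 ((hz.rotate hX.1).adj hX.1).symm
    have hzH : z ∈ H := hX.convex hH hm hw (by omega)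
    have i₃ := ih _ (by omega) hzH rfl
    rw [SimpleGraph.dist_comm (v := v), SimpleGraph.dist_comm (v := v)] at hzv
    omega

/-- An ultrafilter on the set of all half-spaces that differs from a principal one on finitely many
half-spaces is principal. -/
theorem IsCAT0.exists_vertex (hX : X.IsCAT0) {σ : Set (Set V)} (hσ : ∀ H ∈ σ, X.IsHalfSpace H)
    (hc : ∀ H, X.IsHalfSpace H → H ∈ σ ∨ Hᶜ ∈ σ) (hi : ∀ H ∈ σ, ∀ K ∈ σ, (H ∩ K).Nonempty) (v : V)
    (hv : {H ∈ σ | v ∉ H}.Finite) : ∃ u, ∀ H, X.IsHalfSpace H → (H ∈ σ ↔ u ∈ H) := by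
  induction hn : {H ∈ σ | v ∉ H}.ncard using Nat.strong_induction_on generalizing v with
  | _ n ih =>
    subst hn
    by_cases hex : ∃ H ∈ σ, v ∉ H
    · obtain ⟨H, hH, hvH⟩ := hex
      obtain ⟨x, hx⟩ := hi H hH H hH
      obtain ⟨m, hm, hmin⟩ := exists_minimalFor_of_wellFoundedLT (· ∈ H)
        (fun u => X.skeleton.dist v u) ⟨x, hx.1⟩
      have hmin' : ∀ u ∈ H, X.skeleton.dist v m ≤ X.skeleton.dist v u := fun u hu =>
        (le_total _ _).elim id fun h => hmin hu h
      obtain ⟨v', hv', hd⟩ := hX.exists_adj_closer (u := v) (x := m)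
        (by rintro rfl; exact hvH hm)
      -- The edge to `v'` leads towards the gate `m`, hence towards every vertex of `H`. The
      -- half-space it enters thus lies in `σ`, and moving to `v'` removes it from the set of
      -- disagreements without adding any.
      have hHK : H ⊆ X.side v' v := by
        intro u hu
        have h1 := hX.gate (hσ H hH) hm hmin' hu
        have h2 := hX.3.1.dist_triangle (u := v') (v := m) (w := u)
        rw [mem_side, SimpleGraph.dist_comm (v := v'), SimpleGraph.dist_comm (v := v)]
        omega
      have hK : X.side v' v ∈ σ := by
        refine (hc _ (hX.isHalfSpace_side hv'.symm)).resolve_right fun h => ?_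
        obtain ⟨y, hy⟩ := hi H hH _ h
        exact hy.2 (hHK hy.1)
      have hsub : {H ∈ σ | v' ∉ H} ⊆ {H ∈ σ | v ∉ H} := by
        rintro J ⟨hJ, hJv⟩
        refine ⟨hJ, fun hvJ => ?_⟩
        rw [hX.eq_side (hσ J hJ) hv' hvJ hJv] at hJ
        obtain ⟨y, hy⟩ := hi _ hJ _ hK
        rw [← hX.compl_side hv'.symm] at hy
        exact hy.1 hy.2
      refine ih _ (Set.ncard_lt_ncard ⟨hsub, fun h => ?_⟩ hv) v' (hv.subset hsub) rfl
      exact (h (⟨hK, right_notMem_side _ _⟩ : X.side v' v ∈ {H ∈ σ | v ∉ H})).2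
        (left_mem_side hv'.symm)
    · push Not at hex
      refine ⟨v, fun H hH => ⟨hex H, fun hvH => (hc H hH).resolve_right fun h => ?_⟩⟩
      exact hex _ h hvH

end HalfSpaces

/-! ### Cubes are determined by their 1-skeleta -/

section Cubes

variable {V : Type*} {X : CubeFamily V}

/-- The quadrangle condition with target `d` gives a square at `b` whose fourth vertex is at
distance 0 from `d`. -/
theorem IsCAT0.isSquare_of_adj (hX : X.IsCAT0) {a b c d : V} (hab : X.skeleton.Adj a b)
    (hbc : X.skeleton.Adj b c) (hcd : X.skeleton.Adj c d) (hda : X.skeleton.Adj d a)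
    (hac : a ≠ c) (hbd : b ≠ d) : X.IsSquare a b c d := by
  have h1 := hX.dist_adj d hab
  have h2 := SimpleGraph.dist_eq_one_iff_adj.2 hda
  have h3 := SimpleGraph.dist_eq_one_iff_adj.2 hcd
  have h4 := hX.3.1.dist_eq_zero_iff.not.2 hbd.symm
  rw [SimpleGraph.dist_comm] at h3
  obtain ⟨z, hz, hz'⟩ := hX.quadrangle (x := d) hab.symm hbc hac
    (by rw [SimpleGraph.dist_comm (v := d), SimpleGraph.dist_comm (v := d)]; omega)
    (by rw [SimpleGraph.dist_comm (v := d), SimpleGraph.dist_comm (v := d)]; omega)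
  rw [SimpleGraph.dist_comm (v := d), h2] at hz'
  have : z = d := hX.3.1.dist_eq_zero_iff.1 (by omega)
  subst this
  exact (hz.rotate hX.1).reflect hX.1

theorem hammingDist_update {n : ℕ} (x : Fin n → Bool) (i : Fin n) {b : Bool} (h : x i ≠ b) :
    hammingDist x (Function.update x i b) = 1 := by
  rw [hammingDist, Finset.card_eq_one]
  refine ⟨i, ?_⟩
  ext j
  by_cases hj : j = i
  · subst hj
    simpa using h
  · simp [hj]

theorem exists_eq_update_of_hammingDist {n : ℕ} {x y : Fin n → Bool} (h : hammingDist x y = 1) :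
    ∃ i, y = Function.update x i (!(x i)) := by
  rw [hammingDist, Finset.card_eq_one] at h
  obtain ⟨i, hi⟩ := h
  refine ⟨i, ?_⟩
  ext j
  have := Finset.ext_iff.1 hi j
  simp only [Finset.mem_filter, Finset.mem_univ, true_and, Finset.mem_singleton] at this
  by_cases hj : j = i
  · subst hj
    have hne := this.2 rfl
    rw [Function.update_self]
    revert hne
    cases x j <;> cases y j <;> simp
  · rw [Function.update_of_ne hj]
    by_contra hne
    exact hj (this.1 (Ne.symm hne))

theorem IsCube.adj (hX : X.IsCubeComplex) {n : ℕ} {f : (Fin n → Bool) → V} (hf : X.IsCube n f)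
    {x y : Fin n → Bool} (h : hammingDist x y = 1) : X.skeleton.Adj (f x) (f y) := by
  refine ⟨fun he => ?_, f ∘ fun s : Fin 1 → Bool => if s 0 then y else x,
    hX.face n f hf 1 _ ?_, ?_⟩
  · rw [hX.injective n f hf he] at h
    simp at h
  · intro s t
    have hst : hammingDist s t = if s 0 = t 0 then 0 else 1 := by
      revert s t
      decide
    rw [hst]
    cases hs : s 0 <;> cases ht : t 0 <;> simp [hs, ht, h, hammingDist_comm y x]
  · ext v
    simp only [Set.mem_range, Function.comp_apply, Set.mem_insert_iff, Set.mem_singleton_iff]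
    constructor
    · rintro ⟨s, rfl⟩
      cases s 0 <;> simp
    · rintro (rfl | rfl)
      · exact ⟨fun _ => false, rfl⟩
      · exact ⟨fun _ => true, rfl⟩

/-- A cube is present whenever its `1`-skeleton is. -/
theorem IsCAT0.isCube_of_adj (hX : X.IsCAT0) {n : ℕ} {c : (Fin n → Bool) → V}
    (hc : Function.Injective c) (hadj : ∀ x y, hammingDist x y = 1 → X.skeleton.Adj (c x) (c y)) :
    X.IsCube n c := by
  have hup : ∀ (x : Fin n → Bool) i b, x i ≠ b →
      X.skeleton.Adj (c x) (c (Function.update x i b)) :=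
    fun x i b h => hadj _ _ (hammingDist_update x i h)
  have hsq : ∀ (f : (Fin n → Bool) → V), Function.Injective f →
      (∀ x y, hammingDist x y = 1 → X.skeleton.Adj (f x) (f y)) →
      ∀ (x : Fin n → Bool) (i j : Fin n), i ≠ j →
      X.IsSquare (f x) (f (Function.update x i (!(x i))))
        (f (Function.update (Function.update x i (!(x i))) j (!(x j))))
        (f (Function.update x j (!(x j)))) := by
    intro f hf ha x i j hij
    refine hX.isSquare_of_adj (ha _ _ (hammingDist_update _ _ (by simp)))
      (ha _ _ (hammingDist_update _ _ (by simp [hij.symm]))) ?_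
      (ha _ _ (hammingDist_update _ _ (by simp))).symm ?_ ?_
    · rw [Function.update_comm hij]
      exact (ha _ _ (hammingDist_update _ _ (by simp [hij]))).symm
    · intro h
      have := congrFun (hf h) j
      simp at this
    · intro h
      have := congrFun (hf h) j
      simp [hij.symm] at this
  have he : ∀ i : Fin n, (fun j => decide (j = i)) =
      Function.update (fun _ => false : Fin n → Bool) i true := by
    intro i
    ext j
    by_cases h : j = i <;> simp [h]
  obtain ⟨f, hf, hf0, hfi⟩ := hX.2 (c fun _ => false) n (fun i => c fun j => decide (j = i))
    (by
      intro i j hij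
      have := congrFun (hc hij) i
      simpa using this)
    (by
      intro i
      rw [he]
      exact hup _ _ _ (by simp))
    (by
      intro i j hij
      have := (hsq c hc hadj (fun _ => false) i j hij).spansCube
      simpa only [he, Bool.not_false] using this)
  -- The flag condition gives a cube `f` agreeing with `c` at one corner and its neighbours.
  -- Induction on the number of coordinates equal to `true` extends this, each further vertex being
  -- the fourth of a square.
  suffices h : f = c from h ▸ hf
  have hfinj := hX.1.injective n f hf
  have hfadj : ∀ x y, hammingDist x y = 1 → X.skeleton.Adj (f x) (f y) :=
    fun x y h => IsCube.adj hX.1 hf h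
  ext x
  induction hn : (Finset.univ.filter fun i => x i = true).card using Nat.strong_induction_on
    generalizing x with
  | _ m ih =>
    subst hn
    have hlt : ∀ (x : Fin n → Bool) i, x i = true →
        (Finset.univ.filter fun k => Function.update x i false k = true).card <
          (Finset.univ.filter fun k => x k = true).card := by
      intro x i hi
      refine Finset.card_lt_card (Finset.ssubset_iff_of_subset ?_ |>.2 ⟨i, by simpa using hi, by simp⟩)
      intro k
      by_cases hk : k = i
      · subst hk
        simp
      · simp [hk]
    by_cases hij : ∃ i j, i ≠ j ∧ x i = true ∧ x j = true
    · obtain ⟨i, j, hij, hi, hj⟩ := hij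
      have h1 := ih _ (hlt x i hi) (Function.update x i false) rfl
      have h2 := ih _ (hlt x j hj) (Function.update x j false) rfl
      have h3 := ih _ ((hlt (Function.update x i false) j (by simp [hij.symm, hj])).trans (hlt x i hi))
        (Function.update (Function.update x i false) j false) rfl
      have s1 := hsq f hfinj hfadj x i j hij
      have s2 := hsq c hc hadj x i j hij
      simp only [hi, hj, Bool.not_true] at s1 s2
      rw [h1, h2, h3] at s1
      exact ((s1.rotate hX.1).rotate hX.1).unique hX.1 ((s2.rotate hX.1).rotate hX.1)
    · push Not at hij
      by_cases h0 : ∃ i, x i = true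
      · obtain ⟨i, hi⟩ := h0
        have hx : x = fun j => decide (j = i) := by
          ext j
          by_cases hj : j = i
          · simp [hj, hi]
          · simpa [hj] using hij i j (Ne.symm hj) hi
        rw [hx]
        exact hfi i
      · push Not at h0
        have hx : x = fun _ => false := by
          ext j
          simpa using h0 j
        rw [hx]
        exact hf0

end Cubes

/-! ### Bi-infinite geodesics and the half-spaces they cross -/

section Lines

variable {V : Type*} {X : CubeFamily V} {L : ℤ → V}

/-- A bi-infinite geodesic in the `1`-skeleton. -/
def IsLine (X : CubeFamily V) (L : ℤ → V) : Prop :=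
  ∀ i j, (X.skeleton.dist (L i) (L j) : ℤ) = |i - j|

/-- The half-space entered by the `i`-th edge of `L`. -/
def lineSide (X : CubeFamily V) (L : ℤ → V) (i : ℤ) : Set V := X.side (L (i + 1)) (L i)

/-- The half-spaces bounded by the hyperplanes that cross `L`. -/
def lineAxis (X : CubeFamily V) (L : ℤ → V) : Set (Set V) :=
  {K | ∃ i, K = X.lineSide L i ∨ K = (X.lineSide L i)ᶜ}

theorem IsLine.adj (hL : X.IsLine L) (i : ℤ) : X.skeleton.Adj (L i) (L (i + 1)) := by
  simpa using hL i (i + 1)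

theorem IsLine.mem_lineSide (hL : X.IsLine L) {i m : ℤ} : L m ∈ X.lineSide L i ↔ i < m := by
  rw [lineSide, mem_side, ← Int.ofNat_lt, hL, hL]
  rcases lt_or_ge i m with h | h
  · rw [abs_of_nonneg (by omega : (0 : ℤ) ≤ m - (i + 1)), abs_of_pos (by omega : (0 : ℤ) < m - i)]
    omega
  · rw [abs_of_neg (by omega : m - (i + 1) < 0), abs_of_nonpos (by omega : m - i ≤ 0)]
    omega

theorem IsLine.isHalfSpace (hX : X.IsCAT0) (hL : X.IsLine L) (i : ℤ) :
    X.IsHalfSpace (X.lineSide L i) := hX.isHalfSpace_side (hL.adj i).symm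

theorem IsLine.le_of_subset (hL : X.IsLine L) {a b : ℤ}
    (h : X.lineSide L b ⊆ X.lineSide L a) : a ≤ b := by
  have := hL.mem_lineSide.1 (h (hL.mem_lineSide.2 (lt_add_one b)))
  omega

theorem IsLine.injective (hL : X.IsLine L) : Function.Injective (X.lineSide L) := fun _ _ h =>
  (hL.le_of_subset h.ge).antisymm (hL.le_of_subset h.le)

theorem IsLine.ne_compl (hL : X.IsLine L) (a b : ℤ) : X.lineSide L a ≠ (X.lineSide L b)ᶜ := by
  intro h
  have h1 : L (max a b + 1) ∈ X.lineSide L a := hL.mem_lineSide.2 (by omega)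
  rw [h] at h1
  exact h1 (hL.mem_lineSide.2 (by omega))

theorem IsLine.exists_eq_lineSide (hX : X.IsCAT0) (hL : X.IsLine L) {K : Set V}
    (hK : X.IsHalfSpace K) {a b : ℤ} (hab : a ≤ b) (ha : L a ∉ K) (hb : L b ∈ K) :
    ∃ i, K = X.lineSide L i := by
  by_contra! hne
  refine (Int.leInduction (motive := fun b _ => L b ∉ K) ha (fun n _ ih hn => ?_) b hab) hb
  exact hne n (hX.eq_side hK (hL.adj n).symm hn ih)

theorem IsLine.isHalfSpace_of_mem_lineAxis (hX : X.IsCAT0) (hL : X.IsLine L) {K : Set V}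
    (hK : K ∈ X.lineAxis L) : X.IsHalfSpace K := by
  obtain ⟨i, rfl | rfl⟩ := hK
  exacts [hL.isHalfSpace hX i, hX.isHalfSpace_compl (hL.isHalfSpace hX i)]

theorem IsLine.mem_lineAxis (hX : X.IsCAT0) (hL : X.IsLine L) {K : Set V} (hK : X.IsHalfSpace K)
    {a b : ℤ} (ha : L a ∉ K) (hb : L b ∈ K) : K ∈ X.lineAxis L := by
  rcases le_total a b with h | h
  · obtain ⟨i, hi⟩ := hL.exists_eq_lineSide hX hK h ha hb
    exact ⟨i, .inl hi⟩
  · obtain ⟨i, hi⟩ := hL.exists_eq_lineSide hX (hX.isHalfSpace_compl hK) h (not_not.2 hb) ha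
    exact ⟨i, .inr (by rw [← hi, compl_compl])⟩

theorem compl_mem_lineAxis {K : Set V} (hK : K ∈ X.lineAxis L) : Kᶜ ∈ X.lineAxis L := by
  obtain ⟨i, rfl | rfl⟩ := hK
  exacts [⟨i, .inr rfl⟩, ⟨i, .inl (compl_compl _)⟩]

theorem IsLine.exists_mem_of_mem_lineAxis (hL : X.IsLine L) {K : Set V} (hK : K ∈ X.lineAxis L) :
    ∃ i, L i ∈ K := by
  obtain ⟨i, rfl | rfl⟩ := hK
  · exact ⟨i + 1, hL.mem_lineSide.2 (by omega)⟩
  · exact ⟨i, fun h => lt_irrefl _ (hL.mem_lineSide.1 h)⟩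

/-- Every vertex lies in all but finitely many of the half-spaces that contain the negative end of
the line, and in only finitely many of those that contain the positive end. -/
theorem IsLine.eventually_mem (hX : X.IsCAT0) (hL : X.IsLine L) (v : V) :
    ∃ N, ∀ i, (N ≤ i → v ∉ X.lineSide L i) ∧ (i ≤ -N → v ∈ X.lineSide L i) := by
  have h1 : {i | 0 ≤ i ∧ v ∈ X.lineSide L i}.Finite := by
    refine Set.Finite.of_finite_image ((hX.finite_separators (L 0) v).subset ?_)
      hL.injective.injOn
    rintro _ ⟨i, ⟨h0, hi⟩, rfl⟩
    exact ⟨hL.isHalfSpace hX i, fun h => absurd (hL.mem_lineSide.1 h) (by omega), hi⟩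
  have h2 : {i | i < 0 ∧ v ∉ X.lineSide L i}.Finite := by
    refine Set.Finite.of_finite_image ((hX.finite_separators v (L 0)).subset ?_)
      hL.injective.injOn
    rintro _ ⟨i, ⟨h0, hi⟩, rfl⟩
    exact ⟨hL.isHalfSpace hX i, hi, hL.mem_lineSide.2 h0⟩
  obtain ⟨M, hM⟩ := h1.bddAbove
  obtain ⟨N, hN⟩ := h2.bddBelow
  refine ⟨max (|M| + 1) (|N| + 1), fun i => ⟨fun h hv => ?_, fun h => ?_⟩⟩
  · have := abs_nonneg M
    have := le_abs_self M
    have := hM ⟨by omega, hv⟩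
    omega
  · by_contra hv
    have := abs_nonneg N
    have := neg_abs_le N
    have := hN ⟨by omega, hv⟩
    omega

/-- Two lines on which a common period acts as a translation cross the same hyperplanes, in the same
direction. -/
theorem IsLine.exists_lineSide_eq (hX : X.IsCAT0) (hL : X.IsLine L) {L' : ℤ → V}
    (hL' : X.IsLine L') {p : ℤ} (hp : 0 < p)
    (hper : ∀ i j, X.skeleton.dist (L (i + p)) (L' (j + p)) = X.skeleton.dist (L i) (L' j))
    (j : ℤ) : ∃ i, X.lineSide L' j = X.lineSide L i := by
  have hdist : ∀ m i j : ℤ,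
      X.skeleton.dist (L (i + m * p)) (L' (j + m * p)) = X.skeleton.dist (L i) (L' j) := by
    intro m
    induction m using Int.induction_on with
    | zero => simp
    | succ m ih =>
      intro i j
      rw [← ih i j, ← hper (i + m * p)]
      congr 2 <;> ring
    | pred m ih =>
      intro i j
      rw [← ih i j, ← hper]
      congr 2 <;> ring
  have hmem : ∀ m : ℤ, L (m * p) ∈ X.lineSide L' j ↔ L 0 ∈ X.lineSide L' (j - m * p) := by
    intro m
    rw [lineSide, lineSide, mem_side, mem_side, ← hdist m 0, ← hdist m 0]
    simp only [zero_add, show j - m * p + 1 + m * p = j + 1 by ring,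
      show j - m * p + m * p = j by ring]
  obtain ⟨N, hN⟩ := hL'.eventually_mem hX (L 0)
  have hN0 := abs_nonneg N
  have hNN := le_abs_self N
  have hj0 := abs_nonneg j
  have hjj := le_abs_self j
  have hjj' := neg_abs_le j
  have hmul : |N| + |j| ≤ (|N| + |j|) * p := le_mul_of_one_le_right (by omega) (by omega)
  -- As p ≥ 1, shifting `j` by |N| + |j| periods in either direction brings it beyond `N` or `-N`.
  refine hL.exists_eq_lineSide hX (hL'.isHalfSpace hX j) (a := -(|N| + |j|) * p)
    (b := (|N| + |j|) * p) ?_ ?_ ?_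
  · rw [neg_mul]
    omega
  · rw [hmem]
    refine (hN _).1 ?_
    rw [neg_mul]
    omega
  · rw [hmem]
    refine (hN _).2 ?_
    omega

end Lines

/-! ### Automorphisms, powers and axes -/

section Automorphisms

variable {V : Type*} {X : CubeFamily V} {g : Equiv.Perm V}

theorem IsAutomorphism.one : X.IsAutomorphism 1 := fun _ _ => Iff.rfl

theorem IsAutomorphism.mul {h : Equiv.Perm V} (hg : X.IsAutomorphism g) (hh : X.IsAutomorphism h) :
    X.IsAutomorphism (g * h) := fun n f => (hh n f).trans (hg n (h ∘ f))

theorem IsAutomorphism.pow (hg : X.IsAutomorphism g) (n : ℕ) : X.IsAutomorphism (g ^ n) := by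
  induction n with
  | zero => exact .one
  | succ n ih =>
    rw [pow_succ]
    exact ih.mul hg

theorem IsAutomorphism.inv (hg : X.IsAutomorphism g) : X.IsAutomorphism g⁻¹ := by
  intro n f
  rw [hg n (⇑g⁻¹ ∘ f), ← Function.comp_assoc, ← Equiv.Perm.coe_mul, mul_inv_cancel]
  rfl

theorem IsAutomorphism.adj (hg : X.IsAutomorphism g) {a b : V} (h : X.skeleton.Adj a b) :
    X.skeleton.Adj (g a) (g b) := by
  obtain ⟨hne, f, hf, hr⟩ := h
  refine ⟨fun h => hne (g.injective h), g ∘ f, (hg 1 f).1 hf, ?_⟩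
  rw [Set.range_comp, hr, Set.image_pair]

theorem IsAutomorphism.dist_eq (hX : X.IsCAT0) (hg : X.IsAutomorphism g) (a b : V) :
    X.skeleton.dist (g a) (g b) = X.skeleton.dist a b := by
  have key : ∀ {g : Equiv.Perm V}, X.IsAutomorphism g → ∀ a b,
      X.skeleton.dist (g a) (g b) ≤ X.skeleton.dist a b := by
    intro g hg a b
    obtain ⟨p, hp⟩ := hX.3.1.exists_walk_length_eq_dist a b
    have := SimpleGraph.dist_le
      (p.map (⟨g, fun h => hg.adj h⟩ : X.skeleton →g X.skeleton))
    rw [SimpleGraph.Walk.length_map, hp] at this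
    exact this
  refine (key hg a b).antisymm ?_
  simpa using key hg.inv (g a) (g b)

theorem IsAutomorphism.mem_side (hX : X.IsCAT0) (hg : X.IsAutomorphism g) {a b x : V} :
    g x ∈ X.side (g a) (g b) ↔ x ∈ X.side a b := by
  rw [CubeFamily.mem_side, CubeFamily.mem_side, hg.dist_eq hX, hg.dist_eq hX]

theorem IsAutomorphism.isHalfSpace_preimage (hX : X.IsCAT0) (hg : X.IsAutomorphism g) {K : Set V}
    (hK : X.IsHalfSpace K) : X.IsHalfSpace (g ⁻¹' K) := by
  obtain ⟨a, b, hab, rfl⟩ := hX.isHalfSpace_iff.1 hK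
  have : g ⁻¹' X.side a b = X.side (g⁻¹ a) (g⁻¹ b) := by
    ext x
    rw [Set.mem_preimage, ← hg.mem_side hX (a := g⁻¹ a)]
    simp
  rw [this]
  exact hX.isHalfSpace_side (hg.inv.adj hab)

theorem IsAutomorphism.dist_pow_le (hX : X.IsCAT0) (hg : X.IsAutomorphism g) (v : V) (n : ℕ) :
    X.skeleton.dist v ((g ^ n) v) ≤ n * X.skeleton.dist v (g v) := by
  induction n with
  | zero => simp
  | succ n ih =>
    have h1 := hX.3.1.dist_triangle (u := v) (v := (g ^ n) v) (w := (g ^ (n + 1)) v)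
    rw [pow_succ, Equiv.Perm.mul_apply, (hg.pow n).dist_eq hX] at h1
    rw [pow_succ, Equiv.Perm.mul_apply, Nat.add_mul, one_mul]
    omega

theorem translationLength_le (v : V) : X.translationLength g ≤ X.skeleton.dist v (g v) :=
  Nat.sInf_le ⟨v, rfl⟩

theorem exists_mem_minSet [Nonempty V] : ∃ v, v ∈ X.minSet g := by
  obtain ⟨v, hv⟩ := Nat.sInf_mem (Set.range_nonempty fun v => X.skeleton.dist v (g v))
  exact ⟨v, hv⟩

variable {L : ℤ → V}

theorem IsAxis.isLine (hL : X.IsAxis g L) : X.IsLine L := hL.1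

theorem IsAxis.pow_apply (hL : X.IsAxis g L) (n : ℕ) (i : ℤ) :
    (g ^ n) (L i) = L (i + (n * X.translationLength g : ℕ)) := by
  induction n with
  | zero => simp
  | succ n ih =>
    rw [pow_succ', Equiv.Perm.mul_apply, ih, hL.2]
    congr 1
    push_cast
    ring

/-- An automorphism with an axis moves every vertex at least as far as the vertices of the axis. -/
theorem IsAxis.le_dist_pow (hX : X.IsCAT0) (hg : X.IsAutomorphism g) (hL : X.IsAxis g L) (v : V)
    (n : ℕ) : n * X.translationLength g ≤ X.skeleton.dist v ((g ^ n) v) := by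
  by_contra! hlt
  set D := X.skeleton.dist v (L 0)
  -- Each application of `g ^ n` would lose at least 1 against the axis, so 2D + 1 of them lose more
  -- than the 2D allowed by the triangle inequality.
  have h1 := (hg.pow n).dist_pow_le hX v (2 * D + 1)
  have h2 := hX.3.1.dist_triangle (u := L 0) (v := v) (w := ((g ^ n) ^ (2 * D + 1)) (L 0))
  have h3 := hX.3.1.dist_triangle (u := v) (v := ((g ^ n) ^ (2 * D + 1)) v)
    (w := ((g ^ n) ^ (2 * D + 1)) (L 0))
  rw [((hg.pow n).pow _).dist_eq hX] at h3
  rw [SimpleGraph.dist_comm (v := v), ← pow_mul, hL.pow_apply] at h2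
  rw [← pow_mul, hL.pow_apply] at h3
  rw [← pow_mul] at h1
  have h4 := hL.1 0 (0 + (n * (2 * D + 1) * X.translationLength g : ℕ))
  rw [zero_add, zero_sub, abs_neg, Nat.abs_cast, Nat.cast_inj] at h4
  rw [zero_add, h4] at h2
  rw [zero_add] at h3
  have h5 := Nat.mul_le_mul_left (2 * D + 1) hlt
  have h6 : n * (2 * D + 1) * X.translationLength g =
      (2 * D + 1) * (n * X.translationLength g) := by ring
  rw [Nat.mul_succ] at h5
  change _ ≤ D + _ at h2
  change _ ≤ _ + D at h3
  omega

theorem IsAxis.translationLength_pow (hX : X.IsCAT0) (hg : X.IsAutomorphism g)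
    (hL : X.IsAxis g L) (n : ℕ) :
    X.translationLength (g ^ n) = n * X.translationLength g := by
  have : Nonempty V := ⟨L 0⟩
  refine le_antisymm ?_ ?_
  · refine (translationLength_le (L 0)).trans (Nat.cast_le (α := ℤ).1 ?_)
    rw [hL.pow_apply, hL.1]
    simp
  · obtain ⟨v, hv⟩ := exists_mem_minSet (X := X) (g := g ^ n)
    exact hv ▸ hL.le_dist_pow hX hg v n

theorem IsAxis.pow (hX : X.IsCAT0) (hg : X.IsAutomorphism g) (hL : X.IsAxis g L) (n : ℕ) :
    X.IsAxis (g ^ n) L :=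
  ⟨hL.1, fun i => by rw [hL.pow_apply, hL.translationLength_pow hX hg]⟩

/-- All axes have the common period ℓ and hence cross the same hyperplanes, so a single axis
determines the collection. -/
theorem IsAxis.posAxis_eq (hX : X.IsCAT0) (hg : X.IsAutomorphism g) (hL : X.IsAxis g L)
    (hpos : 0 < X.translationLength g) : X.posAxis g = Set.range (X.lineSide L) := by
  ext K
  constructor
  · rintro ⟨hK, L', hL', i, hi, hi'⟩
    obtain ⟨j, hj⟩ := hL.isLine.exists_lineSide_eq hX hL'.isLine (p := X.translationLength g)
      (by exact_mod_cast hpos) (fun i j => by rw [← hL.2, ← hL'.2, hg.dist_eq hX]) i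
    exact ⟨j, by rw [← hj]; exact (hX.eq_side hK (hL'.isLine.adj i).symm hi' hi).symm⟩
  · rintro ⟨i, rfl⟩
    exact ⟨hL.isLine.isHalfSpace hX i, L, hL, i, by simp [hL.isLine.mem_lineSide],
      by simp [hL.isLine.mem_lineSide]⟩

theorem IsAxis.halfSpaceAxis_eq (hX : X.IsCAT0) (hg : X.IsAutomorphism g) (hL : X.IsAxis g L)
    (hpos : 0 < X.translationLength g) : X.halfSpaceAxis g = X.lineAxis L := by
  ext K
  simp only [halfSpaceAxis, hL.posAxis_eq hX hg hpos, lineAxis, Set.mem_union, Set.mem_range,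
    Set.mem_ofPred_eq, exists_or, eq_comm (b := K), eq_compl_comm (x := K), eq_comm (b := Kᶜ)]

theorem IsAxis.mem_lineSide (hX : X.IsCAT0) (hg : X.IsAutomorphism g) (hL : X.IsAxis g L) {i : ℤ}
    {v : V} : g v ∈ X.lineSide L (i + X.translationLength g) ↔ v ∈ X.lineSide L i := by
  rw [lineSide, add_right_comm, ← hL.2, ← hL.2, hg.mem_side hX, lineSide]

theorem IsAxis.image_lineSide (hX : X.IsCAT0) (hg : X.IsAutomorphism g) (hL : X.IsAxis g L)
    (i : ℤ) : g '' X.lineSide L i = X.lineSide L (i + X.translationLength g) := by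
  ext v
  obtain ⟨v, rfl⟩ := g.surjective v
  rw [g.injective.mem_set_image, hL.mem_lineSide hX hg]

theorem IsAxis.lineSide_subset_iff (hX : X.IsCAT0) (hg : X.IsAutomorphism g) (hL : X.IsAxis g L)
    (i j : ℤ) (n : ℕ) : X.lineSide L (i + (n * X.translationLength g : ℕ)) ⊆
      X.lineSide L (j + (n * X.translationLength g : ℕ)) ↔ X.lineSide L i ⊆ X.lineSide L j := by
  rw [← hL.translationLength_pow hX hg, ← (hL.pow hX hg n).image_lineSide hX (hg.pow n),
    ← (hL.pow hX hg n).image_lineSide hX (hg.pow n), Set.image_subset_image_iff (g ^ n).injective]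

end Automorphisms

/-! ### The Sageev construction on the half-spaces of a line -/

section SageevConstruction

variable {V : Type*} {X : CubeFamily V} {L : ℤ → V}

theorem mem_vertexSet_sageev {A : Set (Set V)} {σ : Set (Set V)} :
    σ ∈ (sageev A).vertexSet ↔ σ ∈ sageevVertices A := by
  refine ⟨fun h => h.1 0, fun h => ⟨fun _ => h, fun x y _ => Subsingleton.elim x y, fun x y hxy => ?_⟩⟩
  rw [Subsingleton.elim x y, hammingDist_self] at hxy
  exact absurd hxy zero_ne_one

theorem mem_principal {A : Set (Set V)} {v : V} {K : Set V} :
    K ∈ principal A v ↔ K ∈ A ∧ v ∈ K := Iff.rfl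

theorem principal_mem_sageevVertices {A : Set (Set V)} (hA : ∀ K ∈ A, Kᶜ ∈ A) (v : V) :
    principal A v ∈ sageevVertices A := by
  refine ⟨⟨fun _ h => h.1, fun K hK => ?_, fun H hH K hK => ⟨v, hH.2, hK.2⟩⟩, v, by simp⟩
  by_cases hv : v ∈ K
  · exact .inl ⟨⟨hK, hv⟩, fun h => h.2 hv⟩
  · exact .inr ⟨⟨hA K hK, hv⟩, fun h => hv h.2⟩

theorem IsUltrafilter.compl_notMem {A : Set (Set V)} {σ : Set (Set V)} (h : IsUltrafilter A σ)
    {K : Set V} (hK : K ∈ σ) : Kᶜ ∉ σ := fun h' => by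
  obtain ⟨x, hx⟩ := h.inter K hK _ h'
  exact hx.2 hx.1

theorem TransverseIn.symm {A : Set (Set V)} {H K : Set V} (h : TransverseIn A H K) :
    TransverseIn A K H := by
  obtain ⟨⟨a, ha, h1, h2⟩, ⟨b, hb, h3, h4⟩, ⟨c, hc, h5, h6⟩, d, hd, h7, h8⟩ := h
  exact ⟨⟨a, ha, h2, h1⟩, ⟨c, hc, h6, h5⟩, ⟨b, hb, h4, h3⟩, d, hd, h8, h7⟩

theorem transverseIn_compl_left {A : Set (Set V)} {H K : Set V} :
    TransverseIn A Hᶜ K ↔ TransverseIn A H K := by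
  simp only [TransverseIn, compl_compl]
  tauto

theorem transverseIn_compl_right {A : Set (Set V)} {H K : Set V} :
    TransverseIn A H Kᶜ ↔ TransverseIn A H K := by
  simp only [TransverseIn, compl_compl]
  tauto

theorem FlipAdj.symm {σ τ : Set (Set V)} (h : FlipAdj σ τ) : FlipAdj τ σ := by
  obtain ⟨H, hH, hH', rfl⟩ := h
  have hne : H ≠ Hᶜ := fun h => hH' (h ▸ hH)
  refine ⟨Hᶜ, Set.mem_insert _ _, ?_, ?_⟩
  · rw [compl_compl]
    rintro (h | h)
    exacts [hne h, h.2 rfl]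
  · rw [compl_compl, Set.insert_sdiff_self_of_notMem (fun h => hH' h.1), Set.insert_sdiff_singleton,
      Set.insert_eq_of_mem hH]

/-- Moving on along an edge does not undo the preceding flip, unless it leads back. -/
theorem FlipAdj.compl_mem {σ τ : Set (Set V)} {H : Set V} (hH : H ∈ σ) (hH' : Hᶜ ∉ σ)
    (h : FlipAdj (insert Hᶜ (σ \ {H})) τ) (hne : τ ≠ σ) : Hᶜ ∈ τ := by
  obtain ⟨M, -, -, rfl⟩ := h
  by_cases hM : Hᶜ = M
  · subst hM
    refine absurd ?_ hne
    rw [compl_compl, Set.insert_sdiff_self_of_notMem (fun h => hH' h.1), Set.insert_sdiff_singleton,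
      Set.insert_eq_of_mem hH]
  · exact .inr ⟨Set.mem_insert _ _, hM⟩

/-- Non-nested half-spaces of a line axis are transverse. -/
theorem IsLine.transverseIn_iff (hL : X.IsLine L) {a b : ℤ} (hab : a < b) :
    TransverseIn (X.lineAxis L) (X.lineSide L a) (X.lineSide L b) ↔
      ¬ X.lineSide L b ⊆ X.lineSide L a := by
  constructor
  · rintro ⟨-, -, ⟨σ, hσ, h1, h2⟩, -⟩ h
    obtain ⟨x, hx⟩ := (mem_vertexSet_sageev.1 hσ).1.inter _ h1 _ h2
    exact hx.1 (h hx.2)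
  · intro h
    obtain ⟨x, hxb, hxa⟩ := Set.not_subset.1 h
    have hp : ∀ v, principal (X.lineAxis L) v ∈ (sageev (X.lineAxis L)).vertexSet := fun v =>
      mem_vertexSet_sageev.2 (principal_mem_sageevVertices (fun _ => compl_mem_lineAxis) v)
    have h1 : ∀ i, X.lineSide L i ∈ X.lineAxis L := fun i => ⟨i, .inl rfl⟩
    have h2 : ∀ i, (X.lineSide L i)ᶜ ∈ X.lineAxis L := fun i => ⟨i, .inr rfl⟩
    -- Vertices of the line occupy three quadrants; only the one containing `x` needs non-nesting.
    refine ⟨⟨_, hp (L (b + 1)), ⟨h1 a, ?_⟩, ⟨h1 b, ?_⟩⟩, ⟨_, hp (L b), ⟨h1 a, ?_⟩, ⟨h2 b, ?_⟩⟩,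
      ⟨_, hp x, ⟨h2 a, hxa⟩, ⟨h1 b, hxb⟩⟩, ⟨_, hp (L a), ⟨h2 a, ?_⟩, ⟨h2 b, ?_⟩⟩⟩ <;>
    simp only [Set.mem_compl_iff, hL.mem_lineSide] <;> omega

theorem lineSide_add_mul_subset {p : ℤ} (h : ∀ i, X.lineSide L (i + p) ⊆ X.lineSide L i) (i : ℤ)
    (n : ℕ) : X.lineSide L (i + n * p) ⊆ X.lineSide L i := by
  induction n with
  | zero => simp
  | succ n ih =>
    refine subset_trans ?_ ih
    rw [Nat.cast_succ, add_one_mul, ← add_assoc]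
    exact h _

theorem lineSide_subset_of_emod_eq {p : ℤ} (hp : 0 < p)
    (h : ∀ i, X.lineSide L (i + p) ⊆ X.lineSide L i) {i j : ℤ} (hij : i ≤ j)
    (he : i % p = j % p) : X.lineSide L j ⊆ X.lineSide L i := by
  obtain ⟨q, hq⟩ := Int.ModEq.dvd he
  have hq0 : 0 ≤ q := by
    by_contra! hq0
    nlinarith
  lift q to ℕ using hq0
  have := lineSide_add_mul_subset h i q
  rwa [show i + q * p = j by linarith] at this

/-- If every half-space is nested with its translate by `p`, then all cubes have dimension at most
`p`. -/
theorem IsLine.finiteDimensional (hL : X.IsLine L) {p : ℕ} (hp : 0 < p)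
    (h : ∀ i, X.lineSide L (i + p) ⊆ X.lineSide L i) :
    (sageev (X.lineAxis L)).FiniteDimensional := by
  refine ⟨p, fun n f hf => ?_⟩
  by_contra! hn
  obtain ⟨hv, hinj, hadj⟩ := hf
  set o : Fin n → Bool := fun _ => false with ho
  have hflip : ∀ j, FlipAdj (f o) (f (Function.update o j true)) := fun j =>
    hadj _ _ (hammingDist_update o j (by simp [ho]))
  choose K hK hK' hfK using hflip
  choose i hi using fun j => (hv o).1.subset (hK j)
  -- Pigeonhole: more than `p` directions at the corner `o`, but only `p` residues of their indices.
  obtain ⟨j, -, l, -, hjl, hmod⟩ := Finset.exists_ne_map_eq_of_card_lt_of_maps_to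
    (s := (Finset.univ : Finset (Fin n))) (t := Finset.Ico (0 : ℤ) p) (f := fun j => i j % p)
    (by simpa using hn) (fun j _ => by
      have : (0 : ℤ) < p := by exact_mod_cast hp
      simp only [Finset.coe_Ico, Set.mem_Ico]
      exact ⟨Int.emod_nonneg _ this.ne', Int.emod_lt_of_pos _ this⟩)
  have hKne : K j ≠ K l := by
    intro he
    have h1 := hfK j
    rw [he, ← hfK l] at h1
    have := congrFun (hinj h1) j
    simp [Function.update_of_ne hjl, ho] at this
  -- The four corners of the face at `o` in directions `j` and `l` realise the four quadrants.
  have htr : TransverseIn (X.lineAxis L) (K j) (K l) := by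
    have hvs : ∀ x, f x ∈ (sageev (X.lineAxis L)).vertexSet := fun x =>
      mem_vertexSet_sageev.2 (hv x)
    have hdiag : f (Function.update (Function.update o j true) l true) ≠ f o := by
      intro h
      have := congrFun (hinj h) l
      simp [ho] at this
    refine ⟨⟨_, hvs o, hK j, hK l⟩, ⟨_, hvs (Function.update o l true), ?_, ?_⟩,
      ⟨_, hvs (Function.update o j true), ?_, ?_⟩,
      ⟨_, hvs (Function.update (Function.update o j true) l true), ?_, ?_⟩⟩
    · rw [hfK l]
      exact .inr ⟨hK j, hKne⟩
    · rw [hfK l]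
      exact Set.mem_insert _ _
    · rw [hfK j]
      exact Set.mem_insert _ _
    · rw [hfK j]
      exact .inr ⟨hK l, hKne.symm⟩
    · refine FlipAdj.compl_mem (hK j) (hK' j) ?_ hdiag
      rw [← hfK j]
      exact hadj _ _ (hammingDist_update _ _ (by simp [hjl.symm, ho]))
    · refine FlipAdj.compl_mem (hK l) (hK' l) ?_ hdiag
      rw [← hfK l, Function.update_comm hjl]
      exact hadj _ _ (hammingDist_update _ _ (by simp [hjl, ho]))
  have htr' : TransverseIn (X.lineAxis L) (X.lineSide L (i j)) (X.lineSide L (i l)) := by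
    rcases hi j with h1 | h1 <;> rcases hi l with h2 | h2 <;> rw [h1, h2] at htr <;>
      simpa only [transverseIn_compl_left, transverseIn_compl_right] using htr
  have hp' : (0 : ℤ) < p := by exact_mod_cast hp
  rcases lt_trichotomy (i j) (i l) with hlt | heq | hlt
  · exact (hL.transverseIn_iff hlt).1 htr' (lineSide_subset_of_emod_eq hp' h hlt.le hmod)
  · have h1 := hi j
    have h2 := hi l
    rw [heq] at h1
    have hnot := (hv o).1.compl_notMem (hK j)
    have hnot' := hK l
    rcases h1 with h1 | h1 <;> rcases h2 with h2 | h2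
    · exact hKne (h1.trans h2.symm)
    · rw [h1, ← h2] at hnot
      exact hnot hnot'
    · rw [h1, compl_compl, ← h2] at hnot
      exact hnot hnot'
    · exact hKne (h1.trans h2.symm)
  · exact (hL.transverseIn_iff hlt).1 htr'.symm
      (lineSide_subset_of_emod_eq hp' h hlt.le hmod.symm)

/-- The collection of half-spaces that contains `lineSide L m` for `m ∈ S` and its opposite for
`m ∉ S`. -/
def lineFilter (X : CubeFamily V) (L : ℤ → V) (S : Set ℤ) : Set (Set V) :=
  {K | ∃ m, (m ∈ S ∧ K = X.lineSide L m) ∨ (m ∉ S ∧ K = (X.lineSide L m)ᶜ)}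

theorem IsLine.lineSide_mem_lineFilter (hL : X.IsLine L) {S : Set ℤ} {m : ℤ} :
    X.lineSide L m ∈ X.lineFilter L S ↔ m ∈ S := by
  constructor
  · rintro ⟨m', ⟨hm, h⟩ | ⟨-, h⟩⟩
    · rwa [hL.injective h]
    · exact absurd h (hL.ne_compl _ _)
  · exact fun h => ⟨m, .inl ⟨h, rfl⟩⟩

theorem IsLine.compl_mem_lineFilter (hL : X.IsLine L) {S : Set ℤ} {m : ℤ} :
    (X.lineSide L m)ᶜ ∈ X.lineFilter L S ↔ m ∉ S := by
  constructor
  · rintro ⟨m', ⟨-, h⟩ | ⟨hm, h⟩⟩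
    · exact absurd h.symm (hL.ne_compl _ _)
    · rwa [hL.injective (compl_injective h)]
  · exact fun h => ⟨m, .inr ⟨h, rfl⟩⟩

/-- `hS` excludes disjoint pairs: two positive or two negative half-spaces always meet far out on
the line, so only mixed pairs matter. The bounds give finite difference from the filter of `L 0`,
which corresponds to the indices m < 0. -/
theorem IsLine.lineFilter_mem_sageevVertices (hL : X.IsLine L) {S : Set ℤ} {M N : ℤ}
    (hS : ∀ i j, X.lineSide L j ⊆ X.lineSide L i → j ∈ S → i ∈ S) (hN : ∀ m < N, m ∈ S)
    (hM : ∀ m ∈ S, m ≤ M) : X.lineFilter L S ∈ sageevVertices (X.lineAxis L) := by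
  refine ⟨⟨?_, ?_, ?_⟩, L 0, ?_⟩
  · rintro K ⟨m, ⟨-, rfl⟩ | ⟨-, rfl⟩⟩
    exacts [⟨m, .inl rfl⟩, ⟨m, .inr rfl⟩]
  · rintro K ⟨m, rfl | rfl⟩ <;>
      simp only [compl_compl, hL.lineSide_mem_lineFilter, hL.compl_mem_lineFilter, Xor] <;> tauto
  · have key : ∀ i j, i ∈ S → j ∉ S → (X.lineSide L i ∩ (X.lineSide L j)ᶜ).Nonempty := by
      intro i j hi hj
      by_contra h
      rw [Set.not_nonempty_iff_eq_empty, ← Set.disjoint_iff_inter_eq_empty,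
        Set.disjoint_compl_right_iff_subset] at h
      exact hj (hS j i h hi)
    rintro H ⟨m, ⟨hm, rfl⟩ | ⟨hm, rfl⟩⟩ K ⟨m', ⟨hm', rfl⟩ | ⟨hm', rfl⟩⟩
    · exact ⟨L (max m m' + 1), hL.mem_lineSide.2 (by omega), hL.mem_lineSide.2 (by omega)⟩
    · exact key m m' hm hm'
    · rw [Set.inter_comm]
      exact key m' m hm' hm
    · exact ⟨L (min m m'), fun h => absurd (hL.mem_lineSide.1 h) (by omega),
        fun h => absurd (hL.mem_lineSide.1 h) (by omega)⟩
  · have hfin : (Set.Icc (min N 0) (max M 0)).Finite := Set.finite_Icc _ _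
    refine ((hfin.image (X.lineSide L)).union
      (hfin.image fun m => (X.lineSide L m)ᶜ)).subset fun K hK => ?_
    have hb : ∀ m, ¬ (m ∈ S ↔ m < 0) → m ∈ Set.Icc (min N 0) (max M 0) := by
      intro m hm
      by_contra h
      rw [Set.mem_Icc] at h
      by_cases hmS : m ∈ S
      · have := hM m hmS
        exact hm (iff_of_true hmS (by omega))
      · have := mt (hN m) hmS
        exact hm (iff_of_false hmS (by omega))
    have hKA : K ∈ X.lineAxis L := by
      rcases hK with ⟨⟨m, ⟨-, rfl⟩ | ⟨-, rfl⟩⟩, -⟩ | ⟨hK, -⟩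
      exacts [⟨m, .inl rfl⟩, ⟨m, .inr rfl⟩, hK.1]
    obtain ⟨m, hm⟩ := id hKA
    rw [Set.mem_symmDiff, mem_principal] at hK
    rcases hm with rfl | rfl
    · refine .inl ⟨m, hb m fun h => ?_, rfl⟩
      rw [hL.lineSide_mem_lineFilter, hL.mem_lineSide] at hK
      tauto
    · refine .inr ⟨m, hb m fun h => ?_, rfl⟩
      rw [hL.compl_mem_lineFilter, Set.mem_compl_iff, hL.mem_lineSide] at hK
      tauto

theorem IsLine.flipAdj_lineFilter (hL : X.IsLine L) {S T : Set ℤ} {a : ℤ} (hS : a ∈ S)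
    (hT : a ∉ T) (h : ∀ m, m ≠ a → (m ∈ S ↔ m ∈ T)) :
    FlipAdj (X.lineFilter L S) (X.lineFilter L T) := by
  refine ⟨X.lineSide L a, hL.lineSide_mem_lineFilter.2 hS,
    fun h => hL.compl_mem_lineFilter.1 h hS, ?_⟩
  ext K
  by_cases hK : K ∈ X.lineAxis L
  · rw [Set.mem_insert_iff, Set.mem_sdiff, Set.mem_singleton_iff]
    obtain ⟨m, rfl | rfl⟩ := hK
    · simp only [hL.lineSide_mem_lineFilter, hL.ne_compl, hL.injective.eq_iff, false_or]
      by_cases hm : m = a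
      · subst hm
        tauto
      · have := h m hm
        tauto
    · simp only [hL.compl_mem_lineFilter, compl_inj_iff, (hL.ne_compl _ _).symm,
        hL.injective.eq_iff, not_false_eq_true, and_true]
      by_cases hm : m = a
      · subst hm
        tauto
      · have := h m hm
        tauto
  · have hsub : ∀ S, X.lineFilter L S ⊆ X.lineAxis L := by
      rintro S K ⟨m, ⟨-, rfl⟩ | ⟨-, rfl⟩⟩
      exacts [⟨m, .inl rfl⟩, ⟨m, .inr rfl⟩]
    refine iff_of_false (fun h => hK (hsub _ h)) ?_
    rintro (rfl | h)
    exacts [hK ⟨a, .inr rfl⟩, hK (hsub _ h.1)]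

/-- Pairwise non-nested half-spaces are the directions of a cube. -/
theorem IsLine.exists_isCube (hL : X.IsLine L) {n : ℕ} (a : Fin n → ℤ)
    (ha : ∀ r s, X.lineSide L (a r) ⊆ X.lineSide L (a s) → r = s) :
    ∃ f, (sageev (X.lineAxis L)).IsCube n f := by
  obtain ⟨N, hN⟩ := (Set.finite_range a).bddBelow
  obtain ⟨M, hM⟩ := (Set.finite_range a).bddAbove
  have hN : ∀ r, N ≤ a r := fun r => hN ⟨r, rfl⟩
  have hM : ∀ r, a r ≤ M := fun r => hM ⟨r, rfl⟩
  -- The half-spaces containing some `lineSide L (a r)`, with `lineSide L (a r)` itself switched by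
  -- `x r`; non-nesting makes the switches independent. The indices below `N` supply the negative
  -- end of the line.
  let S : (Fin n → Bool) → Set ℤ := fun x =>
    {m | m < N ∨ ∃ r, X.lineSide L (a r) ⊆ X.lineSide L m ∧ (m = a r → x r = true)}
  have hSa : ∀ x r, a r ∈ S x ↔ x r = true := by
    intro x r
    constructor
    · rintro (h | ⟨s, h, h'⟩)
      · exact absurd h (hN r).not_gt
      · obtain rfl := ha s r h
        exact h' rfl
    · exact fun h => .inr ⟨r, subset_rfl, fun _ => h⟩
  have hSne : ∀ x r b, ∀ m, m ≠ a r → (m ∈ S x ↔ m ∈ S (Function.update x r b)) := by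
    intro x r b m hm
    refine or_congr_right (exists_congr fun s => and_congr_right fun _ => ?_)
    by_cases hs : s = r
    · subst hs
      simp [hm]
    · simp [Function.update_of_ne hs]
  refine ⟨fun x => X.lineFilter L (S x), fun x => ?_, fun x y hxy => ?_, fun x y hxy => ?_⟩
  · refine hL.lineFilter_mem_sageevVertices (M := max M N) (N := N) ?_ (fun m hm => .inl hm) ?_
    · rintro i j hij (hj | ⟨r, hr, hr'⟩)
      · exact .inl ((hL.le_of_subset hij).trans_lt hj)
      · refine .inr ⟨r, hr.trans hij, ?_⟩
        rintro rfl
        exact hr' ((hL.le_of_subset hr).antisymm (hL.le_of_subset hij))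
    · rintro m (hm | ⟨r, hr, -⟩)
      · omega
      · have := hL.le_of_subset hr
        have := hM r
        omega
  · ext r
    rw [Bool.eq_iff_iff, ← hSa x r, ← hSa y r, ← hL.lineSide_mem_lineFilter,
      ← hL.lineSide_mem_lineFilter (S := S y)]
    exact iff_of_eq (congrArg (_ ∈ ·) hxy)
  · obtain ⟨r, rfl⟩ := exists_eq_update_of_hammingDist hxy
    cases hx : x r
    · refine (hL.flipAdj_lineFilter (a := a r) ?_ ?_ fun m hm => ?_).symm
      · rw [hSa]
        simp
      · rw [hSa]
        simp [hx]
      · exact (hSne _ _ _ m hm).symm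
    · refine hL.flipAdj_lineFilter (a := a r) ?_ ?_ fun m hm => hSne _ _ _ m hm
      · rw [hSa, hx]
      · rw [hSa]
        simp

/-- The Sageev construction on the half-spaces dual to a line is realised by the vertices in the
convex hull of the line. -/
theorem IsLine.exists_lift (hX : X.IsCAT0) (hL : X.IsLine L) {σ : Set (Set V)}
    (hσ : σ ∈ sageevVertices (X.lineAxis L)) :
    ∃ v, (∀ K, X.IsHalfSpace K → (∀ i, L i ∈ K) → v ∈ K) ∧ principal (X.lineAxis L) v = σ := by
  obtain ⟨hu, v₀, hfin⟩ := hσ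
  have hcross : ∀ K ∈ X.lineAxis L, ∃ i, L i ∉ K := by
    intro K hK
    obtain ⟨i, hi⟩ := hL.exists_mem_of_mem_lineAxis (compl_mem_lineAxis hK)
    exact ⟨i, hi⟩
  -- A half-space outside the line axis has the whole line on one side; choosing that side extends
  -- `σ` to all half-spaces and places the resulting vertex in the hull.
  obtain ⟨v, hv⟩ := hX.exists_vertex (σ := σ ∪ {K | X.IsHalfSpace K ∧ ∀ i, L i ∈ K}) (v := v₀)
    (by
      rintro K (hK | hK)
      exacts [hL.isHalfSpace_of_mem_lineAxis hX (hu.subset hK), hK.1])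
    (by
      intro K hK
      by_cases h1 : ∀ i, L i ∈ K
      · exact .inl (.inr ⟨hK, h1⟩)
      by_cases h2 : ∀ i, L i ∈ Kᶜ
      · exact .inr (.inr ⟨hX.isHalfSpace_compl hK, h2⟩)
      push Not at h1 h2
      obtain ⟨a, ha⟩ := h1
      obtain ⟨b, hb⟩ := h2
      rcases hu.choice K (hL.mem_lineAxis hX hK ha (not_not.1 hb)) with h | h
      exacts [.inl (.inl h.1), .inr (.inl h.1)])
    (by
      rintro H (hH | hH) K (hK | hK)
      · exact hu.inter H hH K hK
      · obtain ⟨i, hi⟩ := hL.exists_mem_of_mem_lineAxis (hu.subset hH)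
        exact ⟨L i, hi, hK.2 i⟩
      · obtain ⟨i, hi⟩ := hL.exists_mem_of_mem_lineAxis (hu.subset hK)
        exact ⟨L i, hH.2 i, hi⟩
      · exact ⟨L 0, hH.2 0, hK.2 0⟩)
    (by
      refine (hfin.union (hX.finite_separators v₀ (L 0))).subset ?_
      rintro K ⟨hK | hK, hv⟩
      · exact .inl (.inl ⟨hK, fun h => hv h.2⟩)
      · exact .inr ⟨hK.1, hv, hK.2 0⟩)
  refine ⟨v, fun K hK h => (hv K hK).1 (.inr ⟨hK, h⟩), ?_⟩
  ext K
  constructor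
  · rintro ⟨hK, hvK⟩
    refine ((hv K (hL.isHalfSpace_of_mem_lineAxis hX hK)).2 hvK).resolve_right fun h => ?_
    obtain ⟨i, hi⟩ := hcross K hK
    exact hi (h.2 i)
  · exact fun hK => ⟨hu.subset hK,
      (hv K (hL.isHalfSpace_of_mem_lineAxis hX (hu.subset hK))).1 (.inl hK)⟩

/-- A half-space separating two vertices in the convex hull of a line crosses the line. -/
theorem IsLine.mem_lineAxis_of_separates (hX : X.IsCAT0) (hL : X.IsLine L) {v w : V}
    (hv : ∀ K, X.IsHalfSpace K → (∀ i, L i ∈ K) → v ∈ K)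
    (hw : ∀ K, X.IsHalfSpace K → (∀ i, L i ∈ K) → w ∈ K) {K : Set V}
    (hK : K ∈ X.separators v w) : K ∈ X.lineAxis L := by
  obtain ⟨hK, hvK, hwK⟩ := hK
  have h1 := mt (hv K hK) hvK
  have h2 := mt (hw Kᶜ (hX.isHalfSpace_compl hK)) (not_not.2 hwK)
  push Not at h1 h2
  obtain ⟨a, ha⟩ := h1
  obtain ⟨b, hb⟩ := h2
  exact hL.mem_lineAxis hX hK ha (not_not.1 hb)

/-- Between hull vertices only half-spaces of the line axis can separate, so a single flip means
distance 1. -/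
theorem IsLine.adj_of_flipAdj (hX : X.IsCAT0) (hL : X.IsLine L) {v w : V}
    (hv : ∀ K, X.IsHalfSpace K → (∀ i, L i ∈ K) → v ∈ K)
    (hw : ∀ K, X.IsHalfSpace K → (∀ i, L i ∈ K) → w ∈ K)
    (h : FlipAdj (principal (X.lineAxis L) v) (principal (X.lineAxis L) w)) :
    X.skeleton.Adj v w := by
  obtain ⟨H, hH, hH', he⟩ := h
  have hHc := compl_mem_lineAxis hH.1
  rw [← SimpleGraph.dist_eq_one_iff_adj, ← hX.ncard_separators, Set.ncard_eq_one]
  refine ⟨Hᶜ, Set.eq_singleton_iff_unique_mem.2 ⟨⟨hL.isHalfSpace_of_mem_lineAxis hX hHc,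
    not_not.2 hH.2, ?_⟩, fun K hK => ?_⟩⟩
  · have : Hᶜ ∈ principal (X.lineAxis L) w := he ▸ Set.mem_insert _ _
    exact this.2
  · have hKA := hL.mem_lineAxis_of_separates hX hv hw hK
    have : K ∈ principal (X.lineAxis L) w := ⟨hKA, hK.2.2⟩
    rw [he] at this
    exact this.resolve_right fun h => hK.2.1 h.1.2

end SageevConstruction

/-! ### Nesting compared with minimal sets and dimension -/

section Main

variable {V : Type*} {X : CubeFamily V} {g : Equiv.Perm V} {L : ℤ → V}

/-- If each half-space of the axis is nested with its image, then the vertices of the convex hull of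
the axis are moved minimally. -/
theorem IsAxis.mem_minSet (hX : X.IsCAT0) (hg : X.IsAutomorphism g) (hL : X.IsAxis g L)
    (hpos : 0 < X.translationLength g)
    (hn : ∀ i, X.lineSide L (i + X.translationLength g) ⊆ X.lineSide L i) {v : V}
    (hv : ∀ K, X.IsHalfSpace K → (∀ i, L i ∈ K) → v ∈ K) : v ∈ X.minSet g := by
  set p := X.translationLength g with hp
  have hpos' : (0 : ℤ) < p := by exact_mod_cast hpos
  refine le_antisymm ?_ (translationLength_le v)
  have hgv : ∀ K, X.IsHalfSpace K → (∀ i, L i ∈ K) → g v ∈ K := by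
    intro K hK h
    refine hv _ (hg.isHalfSpace_preimage hX hK) fun i => ?_
    rw [Set.mem_preimage, hL.2]
    exact h _
  let I : Set ℤ := {i | v ∉ X.lineSide L i ∧ v ∈ X.lineSide L (i - p)}
  have hmem : ∀ i, g v ∈ X.lineSide L i ↔ v ∈ X.lineSide L (i - p) := by
    intro i
    rw [← hL.mem_lineSide hX hg (i := i - p), ← hp, sub_add_cancel]
  have hsep : X.separators v (g v) ⊆ X.lineSide L '' I := by
    intro K hK
    obtain ⟨i, rfl | rfl⟩ := hL.isLine.mem_lineAxis_of_separates hX hv hgv hK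
    · exact ⟨i, ⟨hK.2.1, (hmem i).1 hK.2.2⟩, rfl⟩
    -- By nesting, `g` takes no vertex out of a half-space `lineSide L i`, so complements do not
    -- contribute separators.
    · have h1 := not_not.1 hK.2.1
      refine absurd ((hmem i).2 ?_) hK.2.2
      have := hn (i - p)
      rw [sub_add_cancel] at this
      exact this h1
  -- In a residue class the half-spaces form a descending chain, and `v` drops out of it at most
  -- once.
  have hinj : Set.InjOn (fun i : ℤ => i % p) I := by
    have key : ∀ i ∈ I, ∀ j ∈ I, i % p = j % p → ¬ i < j := by
      intro i hi j hj hij hlt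
      have hmod : i % p = (j - p) % p := by rw [hij, Int.sub_emod_right]
      refine hi.1 (lineSide_subset_of_emod_eq hpos' hn ?_ hmod hj.2)
      obtain ⟨q, hq⟩ := Int.ModEq.dvd hij
      have : 1 ≤ q := by
        by_contra! h
        nlinarith
      nlinarith
    intro i hi j hj hij
    exact le_antisymm (not_lt.1 (key j hj i hi (Eq.symm hij))) (not_lt.1 (key i hi j hj hij))
  have hmaps : ∀ i ∈ I, i % p ∈ Set.Ico (0 : ℤ) p := fun i _ =>
    ⟨Int.emod_nonneg _ hpos'.ne', Int.emod_lt_of_pos _ hpos'⟩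
  have hIfin : I.Finite := Set.Finite.of_finite_image
    ((Set.finite_Ico (0 : ℤ) p).subset (Set.image_subset_iff.2 hmaps)) hinj
  rw [← hX.ncard_separators]
  calc (X.separators v (g v)).ncard ≤ (X.lineSide L '' I).ncard :=
        Set.ncard_le_ncard hsep (hIfin.image _)
    _ ≤ I.ncard := Set.ncard_image_le hIfin
    _ ≤ (Set.Ico (0 : ℤ) p).ncard :=
        Set.ncard_le_ncard_of_injOn _ hmaps hinj (Set.finite_Ico _ _)
    _ = p := by
        rw [← Finset.coe_Ico, Set.ncard_coe_finset]
        simp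

/-- The orbit of a vertex that is moved minimally does not leave the half-spaces of the axis that it
has entered. -/
theorem IsAxis.map_mem_lineSide (hX : X.IsCAT0) (hg : X.IsAutomorphism g) (hL : X.IsAxis g L)
    (hpos : 0 < X.translationLength g) {v : V} (hv : v ∈ X.minSet g) {i : ℤ}
    (hvi : v ∈ X.lineSide L i) : g v ∈ X.lineSide L i := by
  obtain ⟨N, hN⟩ := hL.isLine.eventually_mem hX v
  set p := X.translationLength g with hp
  -- A high power of `g` moves `v` into `lineSide L i` in any case. As `g v` lies on a geodesic from
  -- `v` to that image, convexity applies.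
  obtain ⟨n, hn⟩ : ∃ n : ℕ, i - ((n + 1 : ℕ) * p : ℕ) ≤ -N := by
    refine ⟨(i + N).toNat, ?_⟩
    have h1 := Int.self_le_toNat (i + N)
    have h2 : (i + N).toNat + 1 ≤ ((i + N).toNat + 1) * p := Nat.le_mul_of_pos_right _ hpos
    omega
  have hend : (g ^ (n + 1)) v ∈ X.lineSide L i := by
    have h := ((hL.pow hX hg (n + 1)).mem_lineSide hX (hg.pow (n + 1))
      (i := i - ((n + 1 : ℕ) * p : ℕ)) (v := v)).2 ((hN _).2 hn)
    rwa [hL.translationLength_pow hX hg, sub_add_cancel] at h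
  refine hX.convex (hL.isLine.isHalfSpace hX i) hvi hend ?_
  have h1 := hL.le_dist_pow hX hg v (n + 1)
  have h2 := hg.dist_pow_le hX v n
  have h3 := hX.3.1.dist_triangle (u := v) (v := g v) (w := (g ^ (n + 1)) v)
  have hv' : X.skeleton.dist v (g v) = p := hv
  rw [hv'] at h2 h3
  rw [pow_succ', Equiv.Perm.mul_apply, hg.dist_eq hX] at h3
  rw [pow_succ', Equiv.Perm.mul_apply] at h1
  rw [pow_succ', Equiv.Perm.mul_apply, hg.dist_eq hX, hv']
  rw [add_one_mul, ← hp] at h1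
  omega

theorem IsAxis.actsNonTransversely_iff (hX : X.IsCAT0) (hg : X.IsAutomorphism g)
    (hL : X.IsAxis g L) (hpos : 0 < X.translationLength g) {k : ℕ} (hk : 0 < k) :
    X.ActsNonTransversely g (g ^ k) ↔
      ∀ i, X.lineSide L (i + (k * X.translationLength g : ℕ)) ⊆ X.lineSide L i := by
  have hp : 0 < k * X.translationLength g := Nat.mul_pos hk hpos
  have himg : ∀ i, (g ^ k) '' X.lineSide L i = X.lineSide L (i + (k * X.translationLength g : ℕ)) := by
    intro i
    rw [(hL.pow hX hg k).image_lineSide hX (hg.pow k), hL.translationLength_pow hX hg]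
  have htr := fun i : ℤ => hL.isLine.transverseIn_iff
    (show i < i + (k * X.translationLength g : ℕ) by omega)
  rw [ActsNonTransversely, hL.halfSpaceAxis_eq hX hg hpos]
  constructor
  · intro h i
    have := h _ ⟨i, .inl rfl⟩
    rwa [himg, htr, not_not] at this
  · rintro h _ ⟨i, rfl | rfl⟩
    · rw [himg, htr, not_not]
      exact h i
    · rw [Set.image_compl_eq (g ^ k).bijective, transverseIn_compl_left, transverseIn_compl_right,
        himg, htr, not_not]
      exact h i

theorem IsAxis.essCharSet_eq_essMinSet (hX : X.IsCAT0) (hg : X.IsAutomorphism g)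
    (hL : X.IsAxis g L) (hpos : 0 < X.translationLength g) {k : ℕ} (hk : 0 < k)
    (hn : ∀ i, X.lineSide L (i + (k * X.translationLength g : ℕ)) ⊆ X.lineSide L i) :
    X.essCharSet g = X.essMinSet (g ^ k) := by
  have hLk := hL.pow hX hg k
  have hgk := hg.pow k
  have hp := hL.translationLength_pow hX hg k
  have hposk : 0 < X.translationLength (g ^ k) := hp ▸ Nat.mul_pos hk hpos
  ext n f
  simp only [essMinSet, essCharSet, hL.halfSpaceAxis_eq hX hg hpos,
    hLk.halfSpaceAxis_eq hX hgk hposk]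
  refine ⟨fun hf => ⟨hf, ?_⟩, And.left⟩
  choose c hc hcf using fun x => hL.isLine.exists_lift hX (hf.1 x)
  refine ⟨n, c, hX.isCube_of_adj ?_ ?_, fun x => ?_, by simp only [hcf]⟩
  · intro x y hxy
    apply hf.2.1
    rw [← hcf, ← hcf, hxy]
  · intro x y hxy
    refine hL.isLine.adj_of_flipAdj hX (hc x) (hc y) ?_
    rw [hcf, hcf]
    exact hf.2.2 x y hxy
  · exact hLk.mem_minSet hX hgk hposk (by rwa [hp]) (hc x)

/-- Replace a vertex `x` of the smaller half-space by a minimally moved vertex with the same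
projection. Its image under `g ^ k` remains in that half-space, and translating back by `g ^ k`
gives membership in the larger one. -/
theorem IsAxis.nested_of_essCharSet_eq (hX : X.IsCAT0) (hg : X.IsAutomorphism g)
    (hL : X.IsAxis g L) (hpos : 0 < X.translationLength g) {k : ℕ} (hk : 0 < k)
    (h : X.essCharSet g = X.essMinSet (g ^ k)) (i : ℤ) :
    X.lineSide L (i + (k * X.translationLength g : ℕ)) ⊆ X.lineSide L i := by
  have hLk := hL.pow hX hg k
  have hgk := hg.pow k
  have hp := hL.translationLength_pow hX hg k
  have hposk : 0 < X.translationLength (g ^ k) := hp ▸ Nat.mul_pos hk hpos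
  intro x hx
  have hA : X.essCharSet g = sageev (X.lineAxis L) := by
    rw [essCharSet, hL.halfSpaceAxis_eq hX hg hpos]
  have hcube : (X.essCharSet g).IsCube 0 fun _ => principal (X.lineAxis L) x := by
    rw [hA]
    exact mem_vertexSet_sageev.2 (principal_mem_sageevVertices (fun _ => compl_mem_lineAxis) x)
  rw [h] at hcube
  obtain ⟨-, m, c, -, hc, hr⟩ := hcube
  rw [hLk.halfSpaceAxis_eq hX hgk hposk] at hr
  have hv : principal (X.lineAxis L) (c fun _ => false) = principal (X.lineAxis L) x := by
    have : principal (X.lineAxis L) (c fun _ => false) ∈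
        Set.range fun _ : Fin 0 → Bool => principal (X.lineAxis L) x := hr ▸ ⟨_, rfl⟩
    obtain ⟨_, h⟩ := this
    exact h.symm
  have hmem : ∀ j, (c fun _ => false) ∈ X.lineSide L j ↔ x ∈ X.lineSide L j := by
    intro j
    have hj : X.lineSide L j ∈ X.lineAxis L := ⟨j, .inl rfl⟩
    have := Set.ext_iff.1 hv (X.lineSide L j)
    simpa only [mem_principal, hj, true_and] using this
  rw [← hmem] at hx ⊢
  have := hLk.map_mem_lineSide hX hgk hposk (hc _) hx
  rwa [← hp, hLk.mem_lineSide hX hgk] at this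

theorem IsAxis.exists_nested (hX : X.IsCAT0) (hg : X.IsAutomorphism g) (hL : X.IsAxis g L)
    (hpos : 0 < X.translationLength g) (hfd : (sageev (X.lineAxis L)).FiniteDimensional) : ∃ k : ℕ, 0 < k ∧
      ∀ i, X.lineSide L (i + (k * X.translationLength g : ℕ)) ⊆ X.lineSide L i := by
  obtain ⟨d, hd⟩ := hfd
  set p := X.translationLength g
  -- The nesting step `r` found below depends on `i`; the factorial is a common multiple of all
  -- possible values.
  refine ⟨(d + 1).factorial, Nat.factorial_pos _, fun i => ?_⟩
  obtain ⟨r, hr0, hrd, hr⟩ : ∃ r : ℕ, 0 < r ∧ r ≤ d + 1 ∧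
      X.lineSide L (i + (r * p : ℕ)) ⊆ X.lineSide L i := by
    by_contra! hne
    -- Otherwise the d + 1 translates of `lineSide L i` by the powers of `g` with exponents 0 to d
    -- would be pairwise non-nested and span a cube of dimension d + 1.
    obtain ⟨f, hf⟩ := hL.isLine.exists_isCube (n := d + 1)
      (fun r => i + ((r : ℕ) * p : ℕ)) (by
        intro r s hrs
        by_contra hne'
        rcases lt_or_gt_of_ne hne' with hlt | hlt
        · have h1 := hL.isLine.le_of_subset hrs
          have h2 : (r : ℕ) * p < s * p := Nat.mul_lt_mul_of_pos_right hlt hpos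
          omega
        · refine hne (r - s) (by omega) (by omega) ?_
          rw [← hL.lineSide_subset_iff hX hg _ _ s]
          convert hrs using 2
          have : (r : ℕ) * p = (r - s : ℕ) * p + s * p := by
            rw [← add_mul, Nat.sub_add_cancel hlt.le]
          rw [this, Nat.cast_add, add_assoc])
    have := hd _ f hf
    omega
  obtain ⟨q, hq⟩ := Nat.dvd_factorial hr0 hrd
  have key : ∀ q : ℕ, X.lineSide L (i + (r * q * p : ℕ)) ⊆ X.lineSide L i := by
    intro q
    induction q with
    | zero => simp
    | succ q ih =>
      have := (hL.lineSide_subset_iff hX hg _ _ (r * q)).2 hr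
      refine subset_trans (subset_of_eq ?_) (this.trans ih)
      congr 1
      push_cast
      ring
  rw [hq]
  exact key q

theorem halfSpaceAxis_eq_empty (X : CubeFamily V) (g : Equiv.Perm V) (h : ¬ ∃ L, X.IsAxis g L) :
    X.halfSpaceAxis g = ∅ := by
  have hpos : X.posAxis g = ∅ := by
    rw [Set.eq_empty_iff_forall_notMem]
    rintro K ⟨-, L, hL, -⟩
    exact h ⟨L, hL⟩
  simp [halfSpaceAxis, hpos]

theorem dimension_eq_zero_of_sageev_empty {n : ℕ} {f : (Fin n → Bool) → Set (Set V)}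
    (hf : (sageev (∅ : Set (Set V))).IsCube n f) : n = 0 := by
  by_contra hn
  have hf0 : ∀ x, f x = ∅ := fun x => Set.subset_empty_iff.1 (hf.1 x).1.subset
  have := congrFun (hf.2.1 ((hf0 fun _ => false).trans (hf0 fun _ => true).symm))
    ⟨0, Nat.pos_of_ne_zero hn⟩
  simp at this

end Main

end CubeFamily

theorem mainTheorem7 {V : Type*} (X : CubeFamily V) (hX : X.IsCAT0)
    (g : Equiv.Perm V) (hg : X.IsHyperbolic g) :
    List.TFAE [
      ∃ k : ℕ, 0 < k ∧ X.ActsNonTransversely g (g ^ k),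
      ∃ k : ℕ, 0 < k ∧ X.essCharSet g = X.essMinSet (g ^ k),
      (X.essCharSet g).FiniteDimensional] := by
  by_cases hax : ∃ L, X.IsAxis g L
  · obtain ⟨L, hL⟩ := hax
    obtain ⟨hg, -, hpos⟩ := hg
    have hA : X.essCharSet g = CubeFamily.sageev (X.lineAxis L) := by
      rw [CubeFamily.essCharSet, hL.halfSpaceAxis_eq hX hg hpos]
    -- Statements 1 and 2 are equivalent for each single k, both meaning nesting with step kℓ.
    have h12 : ∀ k : ℕ, 0 < k →
        (X.ActsNonTransversely g (g ^ k) ↔ X.essCharSet g = X.essMinSet (g ^ k)) := fun k hk =>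
      (hL.actsNonTransversely_iff hX hg hpos hk).trans
        ⟨hL.essCharSet_eq_essMinSet hX hg hpos hk, hL.nested_of_essCharSet_eq hX hg hpos hk⟩
    tfae_have 1 ↔ 2 := exists_congr fun k => and_congr_right (h12 k)
    tfae_have 1 → 3 := by
      rintro ⟨k, hk, h⟩
      rw [hA]
      exact hL.isLine.finiteDimensional (Nat.mul_pos hk hpos)
        ((hL.actsNonTransversely_iff hX hg hpos hk).1 h)
    tfae_have 3 → 1 := by
      intro h
      obtain ⟨k, hk, hn⟩ := hL.exists_nested hX hg hpos (hA ▸ h)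
      exact ⟨k, hk, (hL.actsNonTransversely_iff hX hg hpos hk).2 hn⟩
    tfae_finish
  -- By a theorem of Haglund this case does not occur. It need not be excluded: there are no
  -- half-spaces then, the essential characteristic set is a point, and all three statements hold.
  · have hA : X.halfSpaceAxis g = ∅ := X.halfSpaceAxis_eq_empty g hax
    have := hX.3.1.nonempty
    have h1 : X.ActsNonTransversely g (g ^ 1) := by
      intro H hH
      rw [hA] at hH
      exact absurd hH (Set.notMem_empty _)
    have h2 : X.essCharSet g = X.essMinSet (g ^ 1) := by
      rw [pow_one]
      ext n f
      refine ⟨fun hf => ⟨hf, ?_⟩, And.left⟩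
      rw [CubeFamily.essCharSet, hA] at hf
      obtain rfl := CubeFamily.dimension_eq_zero_of_sageev_empty hf
      obtain ⟨v, hv⟩ := CubeFamily.exists_mem_minSet (X := X) (g := g)
      refine ⟨0, fun _ => v, hX.1.vertex v, fun _ => hv, ?_⟩
      have hf0 : ∀ x, f x = ∅ := fun x => Set.subset_empty_iff.1 (hf.1 x).1.subset
      have hp0 : CubeFamily.principal (X.halfSpaceAxis g) v = ∅ := by
        rw [hA]
        exact Set.subset_empty_iff.1 fun _ h => h.1
      simp only [funext hf0, hp0]
    have h3 : (X.essCharSet g).FiniteDimensional := by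
      rw [CubeFamily.essCharSet, hA]
      exact ⟨0, fun n f hf => (CubeFamily.dimension_eq_zero_of_sageev_empty hf).le⟩
    have h1' : ∃ k : ℕ, 0 < k ∧ X.ActsNonTransversely g (g ^ k) := ⟨1, one_pos, h1⟩
    have h2' : ∃ k : ℕ, 0 < k ∧ X.essCharSet g = X.essMinSet (g ^ k) := ⟨1, one_pos, h2⟩
    tfae_have 1 ↔ 2 := iff_of_true h1' h2'
    tfae_have 1 ↔ 3 := iff_of_true h1' h3
    tfae_finish
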